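/- For integers $m,n\ge 1$ and $p\in[0,1]$ let $\mathbf R\in\{0,1\}^{m\times n}$ be a random matrix with independent entries, each equal to $1$ with probability $p$. It is the representation matrix of a weighted random intersection graph $G$ on the vertex set $[n]$, in which the edge $\{i,j\}$, $i\ne j$, has weight $[\mathbf R^T\mathbf R]_{i,j}$. A 2-coloring $\mathbf x\in\{-1,+1\}^n$ defines a cut of $G$, whose weight is the sum of the weights of the edges $\{i,j\}$ with $x_i=+1$ and $x_j=-1$. A random cut is given by a uniformly random $\mathbf x$; its expected weight (over $\mathbf R$ and $\mathbf x$) is $\frac14\mathbb E\big[\sum_{i\ne j}[\mathbf R^T\mathbf R]_{i,j}\big]$. The Majority Cut algorithm with parameter $\epsilon\in(0,1)$ and a given ordering $v_1,\dots,v_n$ of the vertices (not depending on $\mathbf R$) colors the vertices one after the other: for $t\le\epsilon n$ the color $x_{v_t}$ is $+1$ or $-1$ independently with probability $\frac12$ each, and for $t>\epsilon n$ it is $-1$ if $\sum_{i<t}[\mathbf R^T\mathbf R]_{v_i,v_t}\,x_{v_i}\ge 0$ and $+1$ otherwise. **Theorem.** Let $m=n$ and $p=c/n$. There is a constant $c_0>0$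 such that for every constant $c\ge c_0$ and every $\delta>0$ there are a constant $\beta\ge\sqrt{\frac{16}{27\pi c^3}}-\delta$ and an $\epsilon_0\in(0,1)$ such that for every $\epsilon\in(0,\epsilon_0)$ and all choices of the orderings (one for each $n$), the following holds with probability tending to $1$ as $n\to\infty$ over the choice of $\mathbf R$: the Majority Cut algorithm with parameter $\epsilon$ constructs a cut whose expected weight, over the random choices of the algorithm for the given $\mathbf R$, is at least $$(1+\beta)\,\frac14\,\mathbb E\Big[\sum_{i\neq j}[\mathbf R^T\mathbf R]_{i,j}\Big],$$ that is, at least $1+\beta$ times the expected weight of a random cut. -/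

import Mathlib

open MeasureTheory ProbabilityTheory Filter Topology
open scoped BigOperators Matrix

noncomputable section

/-- The law of the label choices in the weighted random intersection graph model with `n` vertices,
`m` labels and parameter `p`: `ω (ℓ, v)` says whether vertex `v` chooses label `ℓ`, and all these
choices are independent Bernoulli variables with success probability `p`. -/
def labelLaw (m n : ℕ) (p : unitInterval) : Measure (Fin m × Fin n → Bool) :=
  Measure.pi fun _ => bernoulliMeasure true false p

/-- The representation matrix `R ∈ {0,1}^{m × n}`. -/
def repMatrix {m n : ℕ} (ω : Fin m × Fin n → Bool) : Matrix (Fin m) (Fin n) ℝ :=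
  fun ℓ v => if ω (ℓ, v) then 1 else 0

/-- The weight matrix `RᵀR` of the weighted intersection graph with representation matrix `R`. -/
def weightMatrix {m n : ℕ} (R : Matrix (Fin m) (Fin n) ℝ) : Matrix (Fin n) (Fin n) ℝ :=
  Rᵀ * R

/-- The weight of the cut given by a 2-coloring `x ∈ {-1,+1}^n`, with parts `A = {x = +1}` and
`B = {x = -1}`: the total weight of the edges `{i, j}` with `i ∈ A` and `j ∈ B`
(for a symmetric weight matrix `W`; non-edges have weight `0`). -/
def cutWeight {n : ℕ} (W : Matrix (Fin n) (Fin n) ℝ) (x : Fin n → ℤˣ) : ℝ :=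
  ∑ i, ∑ j, if x i = 1 ∧ x j = -1 then W i j else 0

/-- The colors chosen by the Majority Cut algorithm, in the order in which they are chosen: the
`t`-th vertex considered is `σ t` (with `t` counted from `0`), and it receives the color
`majoritySeq W σ ε b t`. The vertices number `1, …, εn` take the color given by their coin `b t`;
each later one looks at the sign of the weighted sum of the colors chosen so far. -/
def majoritySeq {n : ℕ} (W : Matrix (Fin n) (Fin n) ℝ) (σ : Equiv.Perm (Fin n)) (ε : ℝ)
    (b : Fin n → ℤˣ) (t : Fin n) : ℤˣ :=
  open Classical in
  if ((t : ℕ) : ℝ) + 1 ≤ ε * n then b t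
  else if 0 ≤ ∑ i : {i : Fin n // i < t},
      W (σ i.1) (σ t) * (((majoritySeq W σ ε b i.1 : ℤˣ) : ℤ) : ℝ) then -1
  else 1
termination_by t
decreasing_by exact i.2

/-- The 2-coloring of the vertices returned by the Majority Cut algorithm. -/
def majorityCut {n : ℕ} (W : Matrix (Fin n) (Fin n) ℝ) (σ : Equiv.Perm (Fin n)) (ε : ℝ)
    (b : Fin n → ℤˣ) : Fin n → ℤˣ :=
  fun v => majoritySeq W σ ε b (σ.symm v)

/-- The expected weight of the cut constructed by the Majority Cut algorithm on a fixed input, the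
expectation being over its independent fair coins `b ∈ {-1,+1}^n`. -/
def majorityExpectedWeight {n : ℕ} (W : Matrix (Fin n) (Fin n) ℝ) (σ : Equiv.Perm (Fin n))
    (ε : ℝ) : ℝ :=
  𝔼 b : Fin n → ℤˣ, cutWeight W (majorityCut W σ ε b)

/-- The expected weight of a uniformly random cut of a fixed graph. -/
def randomCutExpectedWeight {n : ℕ} (W : Matrix (Fin n) (Fin n) ℝ) : ℝ :=
  𝔼 x : Fin n → ℤˣ, cutWeight W x

/-- The success probability `c / n`, which is read as `1` for the finitely many `n < c`
(here `c > 0`). -/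
def sparseProb (c : ℝ) (n : ℕ) : unitInterval :=
  Set.projIcc (0 : ℝ) 1 zero_le_one (c / n)

end

/-!
For a symmetric weight matrix the cut produced by a sequence of colors has weight
`1 / 2 * ∑ t, g t`, where the gain `g t` of the vertex `t` is the total weight `A t` of its edges to
earlier vertices minus the color of `t` times the color-weighted sum `B t` of these weights. A
random coin contributes the expected gain `A t`, and the majority rule the gain `A t + |B t|`.

Since the order of the vertices is independent of `R`, it may be taken to be the identity. Given the
earlier columns of `R`, we have `B t = ∑ ℓ, y ℓ * R ℓ t` with independent Bernoulli entries `R ℓ t`,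
and `y ℓ` is an odd integer for every label `ℓ` chosen by an odd number of earlier vertices,
*whatever the colors are*. Symmetrization, restriction to those labels and the fourth moment method
bound `E |B t|` below in terms of the number of these labels, which is concentrated around
`m * (1 - (1 - 2 * p) ^ t) / 2`. The centered gains form a martingale difference sequence, so the
second moment method shows that their sum is `O(√n)`, whereas the excess over a random cut is
linear in `n`.
-/

noncomputable section

section FourthMoment

variable {Ω ι : Type*} [MeasurableSpace Ω] {μ : Measure Ω}

lemma integrable_pow_of_memLp [IsFiniteMeasure μ] {X : Ω → ℝ} {q : ℕ} (hX : MemLp X q μ) {k : ℕ}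
    (hk : k ≤ q) : Integrable (fun ω => X ω ^ k) μ := by
  have h := (hX.mono_exponent (Nat.cast_le.2 hk)).integrable_norm_pow'
  refine h.mono' (hX.aestronglyMeasurable.pow k) (.of_forall fun ω => ?_)
  simp only [norm_pow, le_refl]

/-- The difference of the two sides is `|x| (|x| - κ)² (|x| + 2κ)`. -/
lemma three_mul_sq_sub_pow_four_le {κ : ℝ} (hκ : 0 ≤ κ) (x : ℝ) :
    3 * κ ^ 2 * x ^ 2 - x ^ 4 ≤ 2 * κ ^ 3 * |x| := by
  have h : 0 ≤ |x| * (|x| - κ) ^ 2 * (|x| + 2 * κ) := by positivity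
  rw [← sq_abs x, show x ^ 4 = |x| ^ 4 from (Even.pow_abs (by decide) x).symm]
  linarith [show |x| * (|x| - κ) ^ 2 * (|x| + 2 * κ) =
    2 * κ ^ 3 * |x| - (3 * κ ^ 2 * |x| ^ 2 - |x| ^ 4) by ring]

lemma integral_sq_le_mul_integral_abs [IsFiniteMeasure μ] {X : Ω → ℝ} (hX : MemLp X 4 μ) {κ : ℝ}
    (hκ : 0 < κ) (h : ∫ ω, X ω ^ 4 ∂μ ≤ κ ^ 2 * ∫ ω, X ω ^ 2 ∂μ) :
    ∫ ω, X ω ^ 2 ∂μ ≤ κ * ∫ ω, |X ω| ∂μ := by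
  have h2 := integrable_pow_of_memLp (q := 4) hX (k := 2) (by norm_num)
  have h4 := integrable_pow_of_memLp (q := 4) hX le_rfl
  have h1 : Integrable X μ := hX.integrable (by norm_num)
  have hint : 3 * κ ^ 2 * ∫ ω, X ω ^ 2 ∂μ - ∫ ω, X ω ^ 4 ∂μ ≤ 2 * κ ^ 3 * ∫ ω, |X ω| ∂μ := by
    rw [← integral_const_mul, ← integral_const_mul, ← integral_sub (h2.const_mul _) h4]
    exact integral_mono ((h2.const_mul _).sub h4) (h1.abs.const_mul _)
      fun ω => three_mul_sq_sub_pow_four_le hκ.le (X ω)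
  refine le_of_mul_le_mul_left ?_ (show 0 < 2 * κ ^ 2 by positivity)
  linarith [show 2 * κ ^ 3 * ∫ ω, |X ω| ∂μ = 2 * κ ^ 2 * (κ * ∫ ω, |X ω| ∂μ) by ring]

lemma integral_pow_mul_pow_of_indepFun {X Y : Ω → ℝ} (h : IndepFun X Y μ)
    (hX : AEStronglyMeasurable X μ) (hY : AEStronglyMeasurable Y μ) (j k : ℕ) :
    ∫ ω, X ω ^ j * Y ω ^ k ∂μ = (∫ ω, X ω ^ j ∂μ) * ∫ ω, Y ω ^ k ∂μ :=
  (h.comp (measurable_id.pow_const j) (measurable_id.pow_const k)).integral_fun_mul_eq_mul_integral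
    (hX.pow j) (hY.pow k)

lemma integral_add_pow_four_of_indepFun [IsProbabilityMeasure μ] {X Y : Ω → ℝ} (h : IndepFun X Y μ)
    (hX : MemLp X 4 μ) (hY : MemLp Y 4 μ) (hX0 : ∫ ω, X ω ∂μ = 0) (hY0 : ∫ ω, Y ω ∂μ = 0) :
    ∫ ω, (X ω + Y ω) ^ 4 ∂μ =
      ∫ ω, X ω ^ 4 ∂μ + 6 * (∫ ω, X ω ^ 2 ∂μ) * (∫ ω, Y ω ^ 2 ∂μ) + ∫ ω, Y ω ^ 4 ∂μ := by
  have hint : ∀ j ∈ Finset.range 5,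
      Integrable (fun ω => X ω ^ j * Y ω ^ (4 - j) * (Nat.choose 4 j : ℝ)) μ := fun j hj =>
    ((h.comp (measurable_id.pow_const j) (measurable_id.pow_const (4 - j))).integrable_mul
      (integrable_pow_of_memLp (q := 4) hX (Nat.lt_succ_iff.1 (Finset.mem_range.1 hj)))
      (integrable_pow_of_memLp (q := 4) hY (Nat.sub_le 4 j))).mul_const _
  simp only [add_pow, integral_finsetSum _ hint, integral_mul_const,
    integral_pow_mul_pow_of_indepFun h hX.1 hY.1]
  norm_num [Finset.sum_range_succ, hX0, hY0, Nat.choose]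
  ring

lemma integral_sum_sq_of_pairwise_indepFun [IsFiniteMeasure μ] {X : ι → Ω → ℝ}
    {s : Finset ι} (h : Set.Pairwise s fun j k => IndepFun (X j) (X k) μ)
    (hX : ∀ k ∈ s, MemLp (X k) 2 μ) (h0 : ∀ k ∈ s, ∫ ω, X k ω ∂μ = 0) :
    ∫ ω, (∑ k ∈ s, X k ω) ^ 2 ∂μ = ∑ k ∈ s, ∫ ω, X k ω ^ 2 ∂μ := by
  have hsum0 : ∫ ω, (∑ k ∈ s, X k) ω ∂μ = 0 := by
    simp only [Finset.sum_apply]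
    rw [integral_finsetSum _ fun k hk => (hX k hk).integrable one_le_two, Finset.sum_eq_zero h0]
  have hvar := IndepFun.variance_sum hX h
  rw [variance_of_integral_eq_zero (Finset.aemeasurable_sum _ fun k hk => (hX k hk).1.aemeasurable)
    hsum0, Finset.sum_congr rfl fun k hk =>
      variance_of_integral_eq_zero (hX k hk).1.aemeasurable (h0 k hk)] at hvar
  simpa only [Finset.sum_apply] using hvar

lemma integral_sum_pow_four_le {X : ι → Ω → ℝ} (h : iIndepFun X μ)
    (hm : ∀ k, Measurable (X k)) (hX : ∀ k, MemLp (X k) 4 μ) (h0 : ∀ k, ∫ ω, X k ω ∂μ = 0)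
    (s : Finset ι) :
    ∫ ω, (∑ k ∈ s, X k ω) ^ 4 ∂μ ≤
      3 * (∑ k ∈ s, ∫ ω, X k ω ^ 2 ∂μ) ^ 2 + ∑ k ∈ s, ∫ ω, X k ω ^ 4 ∂μ := by
  classical
  have := h.isProbabilityMeasure
  induction s using Finset.induction_on with
  | empty => simp
  | insert k s hk ih =>
    have hind : IndepFun (X k) (fun ω => ∑ j ∈ s, X j ω) μ := by
      simpa only [Finset.sum_fn] using (h.indepFun_finsetSum_of_notMem hm hk).symm
    have hsum0 : ∫ ω, ∑ j ∈ s, X j ω ∂μ = 0 := by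
      rw [integral_finsetSum _ fun j _ => (hX j).integrable (by norm_num),
        Finset.sum_eq_zero fun j _ => h0 j]
    have hsq := integral_sum_sq_of_pairwise_indepFun (s := s)
      (fun i _ j _ hij => h.indepFun hij) (fun j _ => (hX j).mono_exponent (by norm_num))
      fun j _ => h0 j
    simp only [Finset.sum_insert hk]
    rw [integral_add_pow_four_of_indepFun hind (hX k)
      (memLp_finsetSum _ fun j _ => hX j) (h0 k) hsum0, hsq]
    nlinarith [sq_nonneg (∫ ω, X k ω ^ 2 ∂μ)]

end FourthMoment

section Contraction

variable {Ω ι : Type*} [MeasurableSpace Ω] {μ : Measure Ω}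

lemma abs_add_add_abs_sub_le {a b : ℝ} (h : |a| ≤ |b|) (x : ℝ) :
    |x + a| + |x - a| ≤ |x + b| + |x - b| := by
  rcases abs_cases a with ha | ha <;> rcases abs_cases b with hb | hb <;>
    rcases abs_cases (x + a) with h1 | h1 <;> rcases abs_cases (x - a) with h2 | h2 <;>
    linarith [le_abs_self (x + b), neg_abs_le (x + b), le_abs_self (x - b), neg_abs_le (x - b)]

lemma identDistrib_prodMk_neg_right [IsFiniteMeasure μ] {S ξ : Ω → ℝ} (h : IndepFun S ξ μ)
    (hS : AEMeasurable S μ) (hξ : IdentDistrib ξ (-ξ) μ μ) :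
    IdentDistrib (fun ω => (S ω, ξ ω)) (fun ω => (S ω, -ξ ω)) μ μ where
  aemeasurable_fst := hS.prodMk hξ.aemeasurable_fst
  aemeasurable_snd := hS.prodMk hξ.aemeasurable_snd
  map_eq := by
    have hneg : IndepFun S (-ξ) μ := h.neg_right
    have hmap := (indepFun_iff_map_prod_eq_prod_map_map hS hξ.aemeasurable_snd).1 hneg
    rw [(indepFun_iff_map_prod_eq_prod_map_map hS hξ.aemeasurable_fst).1 h, hξ.map_eq]
    exact hmap.symm

lemma integral_abs_add_const_mul_le [IsFiniteMeasure μ] {S ξ : Ω → ℝ} (h : IndepFun S ξ μ)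
    (hS : Integrable S μ) (hint : Integrable ξ μ) (hξ : IdentDistrib ξ (-ξ) μ μ) {a b : ℝ}
    (hab : |a| ≤ |b|) : ∫ ω, |S ω + a * ξ ω| ∂μ ≤ ∫ ω, |S ω + b * ξ ω| ∂μ := by
  have hsymm (c : ℝ) : 2 * ∫ ω, |S ω + c * ξ ω| ∂μ =
      ∫ ω, (|S ω + c * ξ ω| + |S ω - c * ξ ω|) ∂μ := by
    have hflip : ∫ ω, |S ω + c * ξ ω| ∂μ = ∫ ω, |S ω + c * -ξ ω| ∂μ :=
      ((identDistrib_prodMk_neg_right h hS.aemeasurable hξ).comp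
        (u := fun q : ℝ × ℝ => |q.1 + c * q.2|) (by fun_prop)).integral_eq
    simp only [mul_neg, ← sub_eq_add_neg] at hflip
    have hadd : Integrable (fun ω => |S ω + c * ξ ω|) μ := (hS.add (hint.const_mul c)).abs
    have hsub : Integrable (fun ω => |S ω - c * ξ ω|) μ := (hS.sub (hint.const_mul c)).abs
    rw [integral_add hadd hsub, ← hflip, two_mul]
  refine le_of_mul_le_mul_left ?_ two_pos
  rw [hsymm a, hsymm b]
  refine integral_mono ((hS.add (hint.const_mul a)).abs.add (hS.sub (hint.const_mul a)).abs)
    ((hS.add (hint.const_mul b)).abs.add (hS.sub (hint.const_mul b)).abs) fun ω =>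
      abs_add_add_abs_sub_le ?_ (S ω)
  rw [abs_mul, abs_mul]
  gcongr

lemma indepFun_sum_mul_of_notMem {ξ : ι → Ω → ℝ} (h : iIndepFun ξ μ) (hm : ∀ k, Measurable (ξ k))
    (y : ι → ℝ) {s : Finset ι} {k : ι} (hk : k ∉ s) :
    IndepFun (fun ω => ∑ j ∈ s, y j * ξ j ω) (ξ k) μ := by
  have hsum : Measurable fun w : s → ℝ => ∑ j : s, y j * w j := by fun_prop
  have hcomp := (h.indepFun_finset s {k} (Finset.disjoint_singleton_right.2 hk) hm).comp hsum
    (measurable_pi_apply ⟨k, Finset.mem_singleton_self k⟩)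
  convert hcomp using 2 with ω
  · exact (Finset.sum_coe_sort s fun j => y j * ξ j ω).symm
  · rfl

lemma integral_abs_sum_mul_le_of_abs_le [Fintype ι] {ξ : ι → Ω → ℝ} (h : iIndepFun ξ μ)
    (hm : ∀ k, Measurable (ξ k)) (hint : ∀ k, Integrable (ξ k) μ)
    (hξ : ∀ k, IdentDistrib (ξ k) (-ξ k) μ μ) {y z : ι → ℝ} (hzy : ∀ k, |z k| ≤ |y k|) :
    ∫ ω, |∑ k, z k * ξ k ω| ∂μ ≤ ∫ ω, |∑ k, y k * ξ k ω| ∂μ := by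
  classical
  have := h.isProbabilityMeasure
  -- Replace the coefficients one after the other.
  suffices hreplace : ∀ T : Finset ι,
      ∫ ω, |∑ k, T.piecewise z y k * ξ k ω| ∂μ ≤ ∫ ω, |∑ k, y k * ξ k ω| ∂μ by
    simpa only [Finset.piecewise_univ] using hreplace Finset.univ
  intro T
  induction T using Finset.induction_on with
  | empty => simp only [Finset.piecewise_empty, le_refl]
  | insert k T hk ih =>
    refine le_trans ?_ ih
    have hrest (ω : Ω) : ∑ j ∈ Finset.univ.erase k, (insert k T).piecewise z y j * ξ j ω =
        ∑ j ∈ Finset.univ.erase k, T.piecewise z y j * ξ j ω :=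
      Finset.sum_congr rfl fun j hj => by
        rw [Finset.piecewise_insert_of_ne _ _ _ (Finset.ne_of_mem_erase hj)]
    simp only [← Finset.sum_erase_add _ _ (Finset.mem_univ k), hrest,
      Finset.piecewise_insert_self, Finset.piecewise_eq_of_notMem _ _ _ hk]
    exact integral_abs_add_const_mul_le
      (indepFun_sum_mul_of_notMem h hm _ (Finset.notMem_erase k Finset.univ))
      (integrable_finsetSum _ fun j _ => (hint j).const_mul _) (hint k) (hξ k) (hzy k)

end Contraction

section Symmetrization

variable {Ω ι : Type*} [MeasurableSpace Ω] {μ : Measure Ω}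

lemma iIndepFun_sub_prod [Finite ι] {X : ι → Ω → ℝ} (h : iIndepFun X μ)
    (hm : ∀ k, Measurable (X k)) :
    iIndepFun (fun k (q : Ω × Ω) => X k q.1 - X k q.2) (μ.prod μ) := by
  have := h.isProbabilityMeasure
  have := Fintype.ofFinite ι
  suffices hpair : iIndepFun (fun k (q : Ω × Ω) => (X k q.1, X k q.2)) (μ.prod μ) from
    hpair.comp (fun _ x => x.1 - x.2) fun _ => by fun_prop
  have hpi := (iIndepFun_iff_map_fun_eq_pi_map fun k => (hm k).aemeasurable).1 h
  rw [iIndepFun_iff_map_fun_eq_pi_map fun k => by fun_prop]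
  have (k : ι) : IsProbabilityMeasure (μ.map (X k)) :=
    Measure.isProbabilityMeasure_map (hm k).aemeasurable
  have hk (k : ι) :
      (μ.prod μ).map (fun q => (X k q.1, X k q.2)) = (μ.map (X k)).prod (μ.map (X k)) :=
    (Measure.map_prod_map μ μ (hm k) (hm k)).symm
  simp only [hk]
  rw [← (measurePreserving_arrowProdEquivProdArrow ℝ ℝ ι _ _).symm.map_eq, ← hpi,
    Measure.map_prod_map _ _ (by fun_prop) (by fun_prop),
    Measure.map_map (by fun_prop) (by fun_prop)]
  rfl

lemma identDistrib_sub_prod_neg [IsProbabilityMeasure μ] {X : Ω → ℝ} (hX : Measurable X) :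
    IdentDistrib (fun q : Ω × Ω => X q.1 - X q.2) (-fun q : Ω × Ω => X q.1 - X q.2)
      (μ.prod μ) (μ.prod μ) where
  aemeasurable_fst := by fun_prop
  aemeasurable_snd := by fun_prop
  map_eq := by
    have hdiff : Measurable fun q : Ω × Ω => X q.1 - X q.2 := by fun_prop
    conv_lhs => rw [← Measure.prod_swap, Measure.map_map hdiff measurable_swap]
    congr 1
    ext q
    exact (neg_sub _ _).symm

lemma integral_abs_sub_prod_le [IsProbabilityMeasure μ] {X : Ω → ℝ} (hX : Integrable X μ) :
    ∫ q, |X q.1 - X q.2| ∂μ.prod μ ≤ 2 * ∫ ω, |X ω| ∂μ := by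
  have h1 := hX.abs.comp_fst μ
  have h2 := hX.abs.comp_snd μ
  have hfst : ∫ q : Ω × Ω, |X q.1| ∂μ.prod μ = ∫ ω, |X ω| ∂μ := by
    simp [integral_fun_fst (f := fun ω => |X ω|)]
  have hsnd : ∫ q : Ω × Ω, |X q.2| ∂μ.prod μ = ∫ ω, |X ω| ∂μ := by
    simp [integral_fun_snd (f := fun ω => |X ω|)]
  calc ∫ q, |X q.1 - X q.2| ∂μ.prod μ ≤ ∫ q, (|X q.1| + |X q.2|) ∂μ.prod μ :=
        integral_mono ((hX.comp_fst μ).sub (hX.comp_snd μ)).abs (h1.add h2) fun q => abs_sub _ _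
    _ = 2 * ∫ ω, |X ω| ∂μ := by rw [integral_add h1 h2, hfst, hsnd, two_mul]

lemma integral_sub_prod_eq_zero [IsFiniteMeasure μ] {X : Ω → ℝ} (hX : Integrable X μ) :
    ∫ q, (X q.1 - X q.2) ∂μ.prod μ = 0 := by
  rw [integral_sub (hX.comp_fst μ) (hX.comp_snd μ), integral_fun_fst, integral_fun_snd, sub_self]

lemma integral_sub_prod_sq [IsProbabilityMeasure μ] {X : Ω → ℝ} (hX : MemLp X 2 μ) :
    ∫ q, (X q.1 - X q.2) ^ 2 ∂μ.prod μ = 2 * Var[X; μ] := by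
  have hint := hX.integrable one_le_two
  have hmeas : AEMeasurable (fun q : Ω × Ω => X q.1 - X q.2) (μ.prod μ) :=
    ((hint.comp_fst μ).sub (hint.comp_snd μ)).aemeasurable
  have hsub : (fun q : Ω × Ω => X q.1 - X q.2) = fun q => X q.1 + (-X) q.2 :=
    funext fun q => sub_eq_add_neg _ _
  rw [← variance_of_integral_eq_zero hmeas (integral_sub_prod_eq_zero hint), hsub,
    variance_add_prod hX hX.neg, variance_neg, two_mul]

end Symmetrization

section AbsoluteMoment

variable {Ω ι : Type*} [MeasurableSpace Ω] {μ : Measure Ω}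

lemma div_sqrt_le_integral_abs_sum {ξ : ι → Ω → ℝ} (h : iIndepFun ξ μ)
    (hm : ∀ k, Measurable (ξ k)) (hξ : ∀ k ω, |ξ k ω| ≤ 1) (h0 : ∀ k, ∫ ω, ξ k ω ∂μ = 0)
    (s : Finset ι) :
    (∑ k ∈ s, ∫ ω, ξ k ω ^ 2 ∂μ) / √(3 * ∑ k ∈ s, ∫ ω, ξ k ω ^ 2 ∂μ + 1) ≤
      ∫ ω, |∑ k ∈ s, ξ k ω| ∂μ := by
  have := h.isProbabilityMeasure
  have hL (k : ι) (q : ENNReal) : MemLp (ξ k) q μ :=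
    .of_bound (hm k).aestronglyMeasurable 1 (.of_forall (hξ k))
  set v := ∑ k ∈ s, ∫ ω, ξ k ω ^ 2 ∂μ
  have : 0 ≤ v := Finset.sum_nonneg fun k _ => integral_nonneg fun ω => sq_nonneg _
  have hsq : ∫ ω, (∑ k ∈ s, ξ k ω) ^ 2 ∂μ = v :=
    integral_sum_sq_of_pairwise_indepFun (fun i _ j _ hij => h.indepFun hij) (fun k _ => hL k 2)
      fun k _ => h0 k
  have hfourth : ∑ k ∈ s, ∫ ω, ξ k ω ^ 4 ∂μ ≤ v := by
    refine Finset.sum_le_sum fun k _ => integral_mono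
      (integrable_pow_of_memLp (q := 4) (hL k _) le_rfl) (hL k 2).integrable_sq fun ω => ?_
    have := (sq_le_one_iff_abs_le_one _).2 (hξ k ω)
    nlinarith [sq_nonneg (ξ k ω)]
  rw [div_le_iff₀' (by positivity), ← hsq]
  refine integral_sq_le_mul_integral_abs (memLp_finsetSum _ fun k _ => hL k 4) (by positivity) ?_
  rw [hsq, Real.sq_sqrt (by positivity)]
  linarith [integral_sum_pow_four_le h hm (fun k => hL k 4) h0 s]

/-- The lower bound that the fourth moment method gives for the first absolute moment of a linear
form in independent `[0,1]`-valued variables, in terms of the variance `v` of the symmetrized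
form. -/
def absMomentBound (v : ℝ) : ℝ := v / (2 * √(3 * v + 1))

lemma absMomentBound_le_integral_abs_sum_mul [Fintype ι] {X : ι → Ω → ℝ} (h : iIndepFun X μ)
    (hm : ∀ k, Measurable (X k)) (hX : ∀ k ω, X k ω ∈ Set.Icc 0 1) {y : ι → ℝ} {s : Finset ι}
    (hy : ∀ k ∈ s, 1 ≤ |y k|) :
    absMomentBound (2 * ∑ k ∈ s, Var[X k; μ]) ≤ ∫ ω, |∑ k, y k * X k ω| ∂μ := by
  classical
  have := h.isProbabilityMeasure
  have hL (k : ι) (q : ENNReal) : MemLp (X k) q μ :=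
    memLp_of_bounded (.of_forall (hX k)) (hm k).aestronglyMeasurable q
  set ξ : ι → Ω × Ω → ℝ := fun k q => X k q.1 - X k q.2 with hξ
  have hξind : iIndepFun ξ (μ.prod μ) := iIndepFun_sub_prod h hm
  have hξmeas (k : ι) : Measurable (ξ k) := by fun_prop
  have hξle (k : ι) (q : Ω × Ω) : |ξ k q| ≤ 1 := by
    have h1 := hX k q.1
    have h2 := hX k q.2
    exact abs_sub_le_iff.2 ⟨by linarith [h1.2, h2.1], by linarith [h2.2, h1.1]⟩
  have hξint (k : ι) : Integrable (ξ k) (μ.prod μ) :=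
    .of_bound (hξmeas k).aestronglyMeasurable 1 (.of_forall (hξle k))
  have hvar : ∑ k ∈ s, ∫ q, ξ k q ^ 2 ∂μ.prod μ = 2 * ∑ k ∈ s, Var[X k; μ] := by
    rw [Finset.mul_sum]
    exact Finset.sum_congr rfl fun k _ => integral_sub_prod_sq (hL k 2)
  have hsymm (k : ι) := identDistrib_sub_prod_neg (μ := μ) (hm k)
  have hcontr : ∫ q, |∑ k ∈ s, ξ k q| ∂μ.prod μ ≤ ∫ q, |∑ k, y k * ξ k q| ∂μ.prod μ := by
    have hz (k : ι) : |if k ∈ s then 1 else 0| ≤ |y k| := by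
      split_ifs with hk
      · exact abs_one.trans_le (hy k hk)
      · exact abs_zero.trans_le (abs_nonneg _)
    simpa only [ite_mul, one_mul, zero_mul, Finset.sum_ite_mem, Finset.univ_inter] using
      integral_abs_sum_mul_le_of_abs_le hξind hξmeas hξint hsymm hz
  have hfourth := div_sqrt_le_integral_abs_sum hξind hξmeas hξle
    (fun k => integral_sub_prod_eq_zero ((hL k 1).integrable le_rfl)) s
  have hdesymm : ∫ q, |∑ k, y k * ξ k q| ∂μ.prod μ ≤ 2 * ∫ ω, |∑ k, y k * X k ω| ∂μ := by
    simpa only [hξ, mul_sub, Finset.sum_sub_distrib] using integral_abs_sub_prod_le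
      (integrable_finsetSum Finset.univ fun k _ => ((hL k 1).integrable le_rfl).const_mul (y k))
  rw [hvar] at hfourth
  rw [absMomentBound, mul_comm 2 (√_), ← div_div]
  linarith

end AbsoluteMoment

section BlockAverage

variable {ι : Type*} [Fintype ι] [DecidableEq ι] {α : ι → Type*} [∀ i, MeasurableSpace (α i)]
  (μ : (i : ι) → Measure (α i))

/-- The average of `f` over the coordinates in `S`, which are resampled independently: the
conditional expectation of `f` given the coordinates outside `S`. -/
def blockAverage (S : Finset ι) (f : ((i : ι) → α i) → ℝ) (ω : (i : ι) → α i) : ℝ :=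
  ∫ η, f (S.piecewise η ω) ∂Measure.pi μ

variable {μ} {S : Finset ι} {f g : ((i : ι) → α i) → ℝ}

omit [Fintype ι] [∀ i, MeasurableSpace (α i)] in
lemma apply_piecewise_of_dependsOn {β : Type*} {g : ((i : ι) → α i) → β}
    (hg : DependsOn g (S : Set ι)ᶜ) (η ω : (i : ι) → α i) : g (S.piecewise η ω) = g ω :=
  hg fun _ hi => S.piecewise_eq_of_notMem _ _ hi

lemma dependsOn_blockAverage {T : Set ι} (hf : DependsOn f T) (S : Finset ι) :
    DependsOn (blockAverage μ S f) T := fun ω ω' h => by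
  refine integral_congr_ae (.of_forall fun η => hf fun i hi => ?_)
  by_cases hiS : i ∈ S <;> simp [hiS, h i hi]

variable (μ) in
lemma dependsOn_blockAverage_compl (S : Finset ι) (f : ((i : ι) → α i) → ℝ) :
    DependsOn (blockAverage μ S f) (S : Set ι)ᶜ := fun ω ω' h => by
  simp only [blockAverage]
  congr! 3 with η
  ext i
  by_cases hi : i ∈ S
  · simp [hi]
  · simpa [hi] using h i hi

lemma blockAverage_mul_of_dependsOn (hg : DependsOn g (S : Set ι)ᶜ)
    (f : ((i : ι) → α i) → ℝ) (ω : (i : ι) → α i) :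
    blockAverage μ S (fun ω => g ω * f ω) ω = g ω * blockAverage μ S f ω := by
  simp only [blockAverage, apply_piecewise_of_dependsOn hg, integral_const_mul]

omit [Fintype ι] in
lemma measurable_piecewise_prod (S : Finset ι) :
    Measurable fun q : ((i : ι) → α i) × ((i : ι) → α i) => S.piecewise q.2 q.1 := by
  refine measurable_pi_lambda _ fun i => ?_
  by_cases hi : i ∈ S
  · simp only [Finset.piecewise_eq_of_mem _ _ _ hi]
    fun_prop
  · simp only [Finset.piecewise_eq_of_notMem _ _ _ hi]
    fun_prop

variable [∀ i, IsProbabilityMeasure (μ i)]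

variable (μ) in
lemma measurePreserving_piecewise_prod (S : Finset ι) :
    MeasurePreserving (fun q : ((i : ι) → α i) × ((i : ι) → α i) => S.piecewise q.2 q.1)
      ((Measure.pi μ).prod (Measure.pi μ)) (Measure.pi μ) where
  measurable := measurable_piecewise_prod S
  map_eq := by
    refine (Measure.pi_eq fun B hB => ?_).symm
    have hpre : (fun q : ((i : ι) → α i) × ((i : ι) → α i) => S.piecewise q.2 q.1) ⁻¹'
        Set.univ.pi B = Set.univ.pi (S.piecewise (fun _ => Set.univ) B) ×ˢ
          Set.univ.pi (S.piecewise B fun _ => Set.univ) := by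
      ext q
      simp only [Set.mem_preimage, Set.mem_prod, Set.mem_univ_pi, ← forall_and]
      refine forall_congr' fun i => ?_
      by_cases hi : i ∈ S <;> simp [hi]
    rw [Measure.map_apply (measurable_piecewise_prod S) (.univ_pi hB), hpre, Measure.prod_prod,
      Measure.pi_pi, Measure.pi_pi, ← Finset.prod_mul_distrib]
    refine Finset.prod_congr rfl fun i _ => ?_
    by_cases hi : i ∈ S <;> simp [hi]

variable [∀ i, Finite (α i)] [∀ i, MeasurableSingletonClass (α i)]

lemma integral_blockAverage (S : Finset ι) (f : ((i : ι) → α i) → ℝ) :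
    ∫ ω, blockAverage μ S f ω ∂Measure.pi μ = ∫ ω, f ω ∂Measure.pi μ := by
  have hpre := measurePreserving_piecewise_prod μ S
  have hf : AEStronglyMeasurable f (Measure.pi μ) := Integrable.of_finite.aestronglyMeasurable
  calc ∫ ω, blockAverage μ S f ω ∂Measure.pi μ
      = ∫ q, f (S.piecewise q.2 q.1) ∂(Measure.pi μ).prod (Measure.pi μ) :=
        (integral_prod _ (hpre.integrable_comp_of_integrable .of_finite)).symm
    _ = ∫ ω, f ω ∂Measure.pi μ := by
        rw [← integral_map hpre.measurable.aemeasurable (hpre.map_eq.symm ▸ hf), hpre.map_eq]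

lemma integral_mul_blockAverage (hg : DependsOn g (S : Set ι)ᶜ) (f : ((i : ι) → α i) → ℝ) :
    ∫ ω, g ω * blockAverage μ S f ω ∂Measure.pi μ = ∫ ω, g ω * f ω ∂Measure.pi μ := by
  rw [← integral_blockAverage S fun ω => g ω * f ω]
  simp only [blockAverage_mul_of_dependsOn hg]

lemma integral_sub_blockAverage_sq_le (S : Finset ι) (f : ((i : ι) → α i) → ℝ) :
    ∫ ω, (f ω - blockAverage μ S f ω) ^ 2 ∂Measure.pi μ ≤ ∫ ω, f ω ^ 2 ∂Measure.pi μ := by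
  have horth := integral_mul_blockAverage (μ := μ) (dependsOn_blockAverage_compl μ S f) f
  have hexpand (ω : (i : ι) → α i) : (f ω - blockAverage μ S f ω) ^ 2 = f ω ^ 2 -
      blockAverage μ S f ω * f ω - (blockAverage μ S f ω * f ω -
        blockAverage μ S f ω * blockAverage μ S f ω) := by ring
  simp only [hexpand]
  rw [integral_sub .of_finite .of_finite, integral_sub .of_finite .of_finite,
    integral_sub .of_finite .of_finite, ← horth, sub_self, sub_zero]
  exact sub_le_self _ (integral_nonneg fun ω => mul_self_nonneg _)

/-- The differences `X t - blockAverage μ (S t) (X t)` are orthogonal. -/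
lemma integral_sum_sub_blockAverage_sq_le {τ : Type*} [Fintype τ] [LinearOrder τ]
    {S : τ → Finset ι} {X : τ → ((i : ι) → α i) → ℝ}
    (hX : ∀ s t, s < t → DependsOn (X s) (S t : Set ι)ᶜ) :
    ∫ ω, (∑ t, (X t ω - blockAverage μ (S t) (X t) ω)) ^ 2 ∂Measure.pi μ ≤
      ∑ t, ∫ ω, X t ω ^ 2 ∂Measure.pi μ := by
  set d : τ → ((i : ι) → α i) → ℝ := fun t ω => X t ω - blockAverage μ (S t) (X t) ω with hd
  have horth_lt {s t : τ} (hst : s < t) : ∫ ω, d s ω * d t ω ∂Measure.pi μ = 0 := by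
    have hds : DependsOn (d s) (S t : Set ι)ᶜ := fun ω ω' h => by
      simp only [hd]
      rw [hX s t hst h, dependsOn_blockAverage (hX s t hst) (S s) h]
    simp only [hd, mul_sub] at hds ⊢
    rw [integral_sub .of_finite .of_finite, integral_mul_blockAverage hds, sub_self]
  have horth {s t : τ} (hst : s ≠ t) : ∫ ω, d s ω * d t ω ∂Measure.pi μ = 0 := by
    rcases hst.lt_or_gt with h | h
    · exact horth_lt h
    · simpa only [mul_comm] using horth_lt h
  calc ∫ ω, (∑ t, d t ω) ^ 2 ∂Measure.pi μ
      = ∑ s, ∑ t, ∫ ω, d s ω * d t ω ∂Measure.pi μ := by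
        simp only [sq, Finset.sum_mul_sum]
        rw [integral_finsetSum _ fun s _ => .of_finite]
        exact Finset.sum_congr rfl fun s _ => integral_finsetSum _ fun t _ => .of_finite
    _ = ∑ t, ∫ ω, d t ω ^ 2 ∂Measure.pi μ := Finset.sum_congr rfl fun s _ => by
        rw [Finset.sum_eq_single_of_mem s (Finset.mem_univ s) fun t _ hts => horth hts.symm]
        simp only [sq]
    _ ≤ ∑ t, ∫ ω, X t ω ^ 2 ∂Measure.pi μ := Finset.sum_le_sum fun t _ =>
        integral_sub_blockAverage_sq_le (S t) (X t)

omit [DecidableEq ι] in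
variable (μ) in
lemma indepFun_of_dependsOn {β γ : Type*} [MeasurableSpace β] [MeasurableSpace γ]
    {f : ((i : ι) → α i) → β} {g : ((i : ι) → α i) → γ} {S T : Finset ι}
    (hf : DependsOn f S) (hg : DependsOn g T) (hST : Disjoint S T) :
    IndepFun f g (Measure.pi μ) := by
  have hΩ := nonempty_of_isProbabilityMeasure (Measure.pi μ)
  have := hΩ.map f
  have := hΩ.map g
  obtain ⟨f', rfl⟩ := dependsOn_iff_exists_comp.1 hf
  obtain ⟨g', rfl⟩ := dependsOn_iff_exists_comp.1 hg
  have h := (iIndepFun_pi (μ := μ) (X := fun i x => x) fun i => aemeasurable_id').indepFun_finset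
    S T hST fun i => measurable_pi_apply i
  exact h.comp (measurable_of_finite f') (measurable_of_finite g')

end BlockAverage

section MajorityCut

variable {n : ℕ}

lemma sum_ite_ne_eq_two_mul_sum_Iio {G : Fin n → Fin n → ℝ} (hG : ∀ s t, G s t = G t s) :
    (∑ s, ∑ t, if s ≠ t then G s t else 0) = 2 * ∑ t, ∑ s ∈ Finset.Iio t, G s t := by
  have hsplit (s t : Fin n) : (if s ≠ t then G s t else 0) =
      (if s < t then G s t else 0) + if t < s then G t s else 0 := by
    rcases lt_trichotomy s t with h | rfl | h
    · simp [h, h.ne, h.not_gt]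
    · simp
    · simp [h, h.ne', h.not_gt, hG t s]
  simp only [hsplit, Finset.sum_add_distrib]
  rw [Finset.sum_comm, ← two_mul]
  refine congrArg (2 * ·) (Finset.sum_congr rfl fun t _ => ?_)
  rw [← Finset.sum_filter, Finset.filter_gt_eq_Iio]

lemma expect_eq_zero_of_update_neg (t : Fin n) {f : (Fin n → ℤˣ) → ℝ}
    (h : ∀ b, f (Function.update b t (-b t)) = -f b) : 𝔼 b, f b = 0 := by
  have hinv : Function.Involutive fun b : Fin n → ℤˣ => Function.update b t (-b t) := fun b => by
    simp
  have hneg : 𝔼 b, f b = 𝔼 b, -f b :=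
    Fintype.expect_equiv hinv.toPerm _ _ fun b => by simp [h]
  rw [Finset.expect_neg_distrib] at hneg
  linarith

lemma ite_eq_one_and_eq_neg_one (x y : ℤˣ) (w : ℝ) : (if x = 1 ∧ y = -1 then w else 0) =
    1 / 4 * (w + w * (x : ℤ) - w * (y : ℤ) - w * ((x : ℤ) * (y : ℤ))) := by
  rcases Int.units_eq_one_or x with rfl | rfl <;> rcases Int.units_eq_one_or y with rfl | rfl <;>
    (norm_num; try ring)

lemma randomCutExpectedWeight_eq (W : Matrix (Fin n) (Fin n) ℝ) :
    randomCutExpectedWeight W = 1 / 4 * ∑ i, ∑ j, if i ≠ j then W i j else 0 := by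
  have hcolor (i : Fin n) : 𝔼 x : Fin n → ℤˣ, ((x i : ℤ) : ℝ) = 0 :=
    expect_eq_zero_of_update_neg i fun b => by simp
  have hpair (i j : Fin n) : 𝔼 x : Fin n → ℤˣ, (if x i = 1 ∧ x j = -1 then W i j else 0) =
      1 / 4 * if i ≠ j then W i j else 0 := by
    simp only [ite_eq_one_and_eq_neg_one, ← Finset.mul_expect, Finset.expect_sub_distrib,
      Finset.expect_add_distrib, Fintype.expect_const, hcolor]
    rcases eq_or_ne i j with rfl | hij
    · simp [← Int.cast_mul, ← Units.val_mul]
    · rw [expect_eq_zero_of_update_neg i fun b => by simp [Function.update_of_ne hij.symm],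
        if_pos hij]
      ring
  simp only [randomCutExpectedWeight, cutWeight, Finset.expect_sum_comm, hpair, Finset.mul_sum]

lemma cutWeight_eq_sum_Iio {W : Matrix (Fin n) (Fin n) ℝ} (hW : W.IsSymm) (x : Fin n → ℤˣ) :
    cutWeight W x = 1 / 2 * ∑ t, ((∑ i ∈ Finset.Iio t, W i t) -
      (x t : ℤ) * ∑ i ∈ Finset.Iio t, W i t * (x i : ℤ)) := by
  have hterm (i j : Fin n) : (if x i = 1 ∧ x j = -1 then W i j else 0) =
      1 / 4 * (if i ≠ j then W i j * (1 - (x i : ℤ) * (x j : ℤ)) else 0) +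
        (1 / 4 * (W i j * (x i : ℤ)) - 1 / 4 * (W i j * (x j : ℤ))) := by
    rw [ite_eq_one_and_eq_neg_one]
    rcases eq_or_ne i j with rfl | hij
    · simp [← Int.cast_mul, ← Units.val_mul]
    · rw [if_pos hij]
      ring
  have hswap : ∑ i, ∑ j, 1 / 4 * (W i j * (x j : ℤ)) = ∑ i, ∑ j, 1 / 4 * (W i j * (x i : ℤ)) := by
    rw [Finset.sum_comm]
    simp only [hW.apply]
  calc cutWeight W x
      = 1 / 4 * ∑ i, ∑ j, if i ≠ j then W i j * (1 - (x i : ℤ) * (x j : ℤ)) else 0 := by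
        simp only [cutWeight, hterm, Finset.sum_add_distrib, Finset.sum_sub_distrib]
        rw [hswap, sub_self, add_zero]
        simp only [Finset.mul_sum]
    _ = 1 / 2 * ∑ t, ∑ i ∈ Finset.Iio t, W i t * (1 - (x i : ℤ) * (x t : ℤ)) := by
        rw [sum_ite_ne_eq_two_mul_sum_Iio fun i j => by rw [hW.apply, mul_comm ((x i : ℤ) : ℝ)]]
        ring
    _ = 1 / 2 * ∑ t, ((∑ i ∈ Finset.Iio t, W i t) -
          (x t : ℤ) * ∑ i ∈ Finset.Iio t, W i t * (x i : ℤ)) := by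
        simp only [Finset.mul_sum, ← Finset.sum_sub_distrib]
        simp only [mul_sub, mul_one, mul_left_comm, mul_comm]

/-- The sum whose sign determines the color of the `t`-th vertex in the majority phase of the
Majority Cut algorithm, for the order `0, 1, …, n - 1` of the vertices. -/
def majoritySum (W : Matrix (Fin n) (Fin n) ℝ) (ε : ℝ) (b : Fin n → ℤˣ) (t : Fin n) : ℝ :=
  ∑ i ∈ Finset.Iio t, W i t * (majoritySeq W 1 ε b i : ℤ)

lemma majoritySeq_one_eq (W : Matrix (Fin n) (Fin n) ℝ) (ε : ℝ) (b : Fin n → ℤˣ) (t : Fin n) :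
    majoritySeq W 1 ε b t =
      if ((t : ℕ) : ℝ) + 1 ≤ ε * n then b t else if 0 ≤ majoritySum W ε b t then -1 else 1 := by
  have h : majoritySum W ε b t = ∑ i : {i : Fin n // i < t},
      W i.1 t * ((majoritySeq W 1 ε b i.1 : ℤ) : ℝ) := Finset.sum_subtype _ (by simp) _
  rw [majoritySeq, h]
  rfl

lemma majoritySeq_submatrix (W : Matrix (Fin n) (Fin n) ℝ) (σ : Equiv.Perm (Fin n)) (ε : ℝ)
    (b : Fin n → ℤˣ) (t : Fin n) :
    majoritySeq (W.submatrix σ σ) 1 ε b t = majoritySeq W σ ε b t := by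
  induction t using WellFoundedLT.induction with
  | _ t ih =>
    rw [majoritySeq, majoritySeq]
    simp only [fun i : {i : Fin n // i < t} => ih i i.2]
    rfl

lemma majorityExpectedWeight_submatrix (W : Matrix (Fin n) (Fin n) ℝ) (σ : Equiv.Perm (Fin n))
    (ε : ℝ) : majorityExpectedWeight (W.submatrix σ σ) 1 ε = majorityExpectedWeight W σ ε := by
  refine (Finset.expect_congr rfl fun b _ => ?_).symm
  rw [cutWeight, ← Equiv.sum_comp σ]
  refine Finset.sum_congr rfl fun s _ => ?_
  rw [← Equiv.sum_comp σ]
  simp only [majorityCut, Equiv.symm_apply_apply, ← majoritySeq_submatrix W σ]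
  rfl

lemma majoritySeq_congr {W W' : Matrix (Fin n) (Fin n) ℝ} {ε : ℝ} {b b' : Fin n → ℤˣ} {u : Fin n}
    (hW : ∀ i j, i < u → j < u → W i j = W' i j) (hb : ∀ i < u, b i = b' i) {t : Fin n}
    (ht : t < u) : majoritySeq W 1 ε b t = majoritySeq W' 1 ε b' t := by
  induction t using WellFoundedLT.induction with
  | _ t ih =>
    have h : majoritySum W ε b t = majoritySum W' ε b' t :=
      Finset.sum_congr rfl fun i hi => by
        rw [hW i t ((Finset.mem_Iio.1 hi).trans ht) ht,
          ih i (Finset.mem_Iio.1 hi) ((Finset.mem_Iio.1 hi).trans ht)]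
    rw [majoritySeq_one_eq, majoritySeq_one_eq, h, hb t ht]

lemma majoritySeq_mul_majoritySum_of_lt (W : Matrix (Fin n) (Fin n) ℝ) {ε : ℝ} (b : Fin n → ℤˣ)
    {t : Fin n} (ht : ε * n < t + 1) :
    (majoritySeq W 1 ε b t : ℤ) * majoritySum W ε b t = -|majoritySum W ε b t| := by
  rw [majoritySeq_one_eq, if_neg ht.not_ge]
  split_ifs with h
  · simp [abs_of_nonneg h]
  · simp [abs_of_neg (not_le.1 h)]

lemma expect_majoritySeq_mul_majoritySum_of_le (W : Matrix (Fin n) (Fin n) ℝ) {ε : ℝ} {t : Fin n}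
    (ht : (t : ℝ) + 1 ≤ ε * n) :
    𝔼 b, (majoritySeq W 1 ε b t : ℤ) * majoritySum W ε b t = 0 := by
  refine expect_eq_zero_of_update_neg t fun b => ?_
  have h : majoritySum W ε (Function.update b t (-b t)) t = majoritySum W ε b t :=
    Finset.sum_congr rfl fun i hi => by
      rw [majoritySeq_congr (u := t) (fun _ _ _ _ => rfl)
        (fun j hj => Function.update_of_ne hj.ne _ b) (Finset.mem_Iio.1 hi)]
  rw [h, majoritySeq_one_eq, majoritySeq_one_eq, if_pos ht, if_pos ht]
  simp

/-- Twice the expected weight that the algorithm gains when it colors the `t`-th vertex, the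
vertices being taken in the order `0, 1, …, n - 1`. -/
def meanGain (W : Matrix (Fin n) (Fin n) ℝ) (ε : ℝ) (t : Fin n) : ℝ :=
  (∑ i ∈ Finset.Iio t, W i t) +
    if (t : ℝ) + 1 ≤ ε * n then 0 else 𝔼 b : Fin n → ℤˣ, |majoritySum W ε b t|

lemma majorityExpectedWeight_one_eq {W : Matrix (Fin n) (Fin n) ℝ} (hW : W.IsSymm) (ε : ℝ) :
    majorityExpectedWeight W 1 ε = 1 / 2 * ∑ t, meanGain W ε t := by
  have hgain (t : Fin n) : 𝔼 b, ((∑ i ∈ Finset.Iio t, W i t) -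
      (majoritySeq W 1 ε b t : ℤ) * majoritySum W ε b t) = meanGain W ε t := by
    rw [Finset.expect_sub_distrib, Fintype.expect_const, meanGain]
    split_ifs with ht
    · rw [expect_majoritySeq_mul_majoritySum_of_le W ht, sub_zero, add_zero]
    · simp only [majoritySeq_mul_majoritySum_of_lt W _ (not_le.1 ht), Finset.expect_neg_distrib,
        sub_neg_eq_add]
  simp only [majorityExpectedWeight, cutWeight_eq_sum_Iio hW, ← Finset.mul_expect,
    Finset.expect_sum_comm, ← hgain]
  rfl

lemma abs_majoritySum_le {W : Matrix (Fin n) (Fin n) ℝ} (hW : ∀ i j, 0 ≤ W i j) (ε : ℝ)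
    (b : Fin n → ℤˣ) (t : Fin n) : |majoritySum W ε b t| ≤ ∑ i ∈ Finset.Iio t, W i t := by
  refine (Finset.abs_sum_le_sum_abs _ _).trans (Finset.sum_le_sum fun i _ => ?_)
  rcases Int.units_eq_one_or (majoritySeq W 1 ε b i) with h | h <;>
    simp [h, abs_of_nonneg (hW i t)]

lemma abs_meanGain_le {W : Matrix (Fin n) (Fin n) ℝ} (hW : ∀ i j, 0 ≤ W i j) (ε : ℝ)
    (t : Fin n) : |meanGain W ε t| ≤ 2 * ∑ i ∈ Finset.Iio t, W i t := by
  have hsum : 0 ≤ ∑ i ∈ Finset.Iio t, W i t := Finset.sum_nonneg fun i _ => hW i t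
  have hle : 𝔼 b : Fin n → ℤˣ, |majoritySum W ε b t| ≤ ∑ i ∈ Finset.Iio t, W i t :=
    Finset.expect_le Finset.univ_nonempty fun b _ => abs_majoritySum_le hW ε b t
  have hnonneg : 0 ≤ 𝔼 b : Fin n → ℤˣ, |majoritySum W ε b t| :=
    Finset.expect_nonneg fun b _ => abs_nonneg _
  rw [meanGain, abs_le]
  split_ifs <;> constructor <;> linarith

end MajorityCut

section LabelLaw

variable {m n : ℕ}

instance (p : unitInterval) : IsProbabilityMeasure (labelLaw m n p) := by
  unfold labelLaw
  infer_instance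

variable (p : unitInterval)

lemma measurePreserving_comp_prodMap (σ : Equiv.Perm (Fin n)) :
    MeasurePreserving (fun (ω : Fin m × Fin n → Bool) k => ω (k.1, σ k.2)) (labelLaw m n p)
      (labelLaw m n p) :=
  measurePreserving_arrowCongr' (fun _ => bernoulliMeasure true false p)
    (fun _ => bernoulliMeasure true false p) ((Equiv.refl (Fin m)).prodCongr σ.symm)
    (MeasurableEquiv.refl Bool) fun _ => .id _

lemma integral_prod_labelLaw (s : Finset (Fin m × Fin n)) (g : Bool → ℝ) :
    ∫ ω, ∏ k ∈ s, g (ω k) ∂labelLaw m n p = (p * g true + (1 - p) * g false) ^ s.card := by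
  have h := integral_fintype_prod_eq_prod
    (μ := fun _ : Fin m × Fin n => bernoulliMeasure true false p)
    fun k b => if k ∈ s then g b else 1
  have hone (k : Fin m × Fin n) : ∫ b, (if k ∈ s then g b else 1) ∂bernoulliMeasure true false p =
      if k ∈ s then p * g true + (1 - p) * g false else 1 := by
    rw [integral_bernoulliMeasure]
    split_ifs <;> simp
  simp only [hone, Fintype.prod_ite_mem, Finset.prod_const] at h
  exact h

lemma integral_repMatrix (ℓ : Fin m) (v : Fin n) :
    ∫ ω, repMatrix ω ℓ v ∂labelLaw m n p = p := by
  simpa [repMatrix] using integral_prod_labelLaw p {(ℓ, v)} fun b => if b then 1 else 0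

lemma repMatrix_sq (ω : Fin m × Fin n → Bool) (ℓ : Fin m) (v : Fin n) :
    repMatrix ω ℓ v ^ 2 = repMatrix ω ℓ v := by
  simp [repMatrix]

lemma repMatrix_mem_Icc (ω : Fin m × Fin n → Bool) (ℓ : Fin m) (v : Fin n) :
    repMatrix ω ℓ v ∈ Set.Icc 0 1 := by
  unfold repMatrix
  split_ifs <;> simp

lemma variance_repMatrix (ℓ : Fin m) (v : Fin n) :
    Var[fun ω => repMatrix ω ℓ v; labelLaw m n p] = p * (1 - p) := by
  rw [variance_eq_sub (MemLp.of_discrete (p := 2))]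
  simp only [Pi.pow_apply, repMatrix_sq, integral_repMatrix]
  ring

lemma iIndepFun_repMatrix :
    iIndepFun (fun (k : Fin m × Fin n) ω => repMatrix ω k.1 k.2) (labelLaw m n p) :=
  iIndepFun_pi (X := fun _ (b : Bool) => if b then (1 : ℝ) else 0) fun _ =>
    (measurable_of_finite _).aemeasurable

lemma integral_sum_mul_repMatrix (s : Finset (Fin m × Fin n)) (a : Fin m × Fin n → ℝ) :
    ∫ ω, ∑ k ∈ s, a k * repMatrix ω k.1 k.2 ∂labelLaw m n p = p * ∑ k ∈ s, a k := by
  rw [integral_finsetSum _ fun k _ => .of_finite, Finset.mul_sum]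
  simp only [integral_const_mul, integral_repMatrix, mul_comm]

lemma variance_sum_mul_repMatrix (s : Finset (Fin m × Fin n)) (a : Fin m × Fin n → ℝ) :
    Var[fun ω => ∑ k ∈ s, a k * repMatrix ω k.1 k.2; labelLaw m n p] =
      p * (1 - p) * ∑ k ∈ s, a k ^ 2 := by
  have hind (k : Fin m × Fin n) (_ : k ∈ s) (j : Fin m × Fin n) (_ : j ∈ s) (hkj : k ≠ j) :
      IndepFun (fun ω => a k * repMatrix ω k.1 k.2) (fun ω => a j * repMatrix ω j.1 j.2)
        (labelLaw m n p) :=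
    ((iIndepFun_repMatrix p).indepFun hkj).comp (measurable_const_mul _) (measurable_const_mul _)
  have h := IndepFun.variance_sum (fun k _ => MemLp.of_discrete) hind
  simp only [variance_const_mul, variance_repMatrix, ← Finset.sum_mul] at h
  rw [mul_comm, ← h]
  congr! 1
  ext ω
  simp

lemma integral_sum_mul_repMatrix_sq_le (s : Finset (Fin m × Fin n)) (a : Fin m × Fin n → ℝ) :
    ∫ ω, (∑ k ∈ s, a k * repMatrix ω k.1 k.2) ^ 2 ∂labelLaw m n p ≤
      p * ∑ k ∈ s, a k ^ 2 + p ^ 2 * (∑ k ∈ s, a k) ^ 2 := by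
  have hvar := variance_eq_sub (μ := labelLaw m n p) (MemLp.of_discrete (p := 2)
    (f := fun ω => ∑ k ∈ s, a k * repMatrix ω k.1 k.2))
  rw [variance_sum_mul_repMatrix, integral_sum_mul_repMatrix] at hvar
  have hnonneg : 0 ≤ (p : ℝ) ^ 2 * ∑ k ∈ s, a k ^ 2 := by positivity
  simp only [Pi.pow_apply] at hvar
  linarith [show (p : ℝ) * (1 - p) * ∑ k ∈ s, a k ^ 2 =
    p * ∑ k ∈ s, a k ^ 2 - (p : ℝ) ^ 2 * ∑ k ∈ s, a k ^ 2 by ring]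

end LabelLaw

section Concentration

variable {Ω : Type*} [MeasurableSpace Ω] {μ : Measure Ω} [IsProbabilityMeasure μ]

lemma sq_integral_abs_le_integral_sq {X : Ω → ℝ} (hX : MemLp X 2 μ) :
    (∫ ω, |X ω| ∂μ) ^ 2 ≤ ∫ ω, X ω ^ 2 ∂μ := by
  have h := variance_nonneg (fun ω => |X ω|) μ
  rw [variance_eq_sub (X := fun ω => |X ω|) hX.abs] at h
  simpa only [Pi.pow_apply, sq_abs, sub_nonneg] using h

lemma integral_abs_sub_integral_le_sqrt_variance {X : Ω → ℝ} (hX : MemLp X 2 μ) :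
    ∫ ω, |X ω - ∫ ω', X ω' ∂μ| ∂μ ≤ √Var[X; μ] := by
  rw [variance_eq_integral hX.aestronglyMeasurable.aemeasurable]
  exact Real.le_sqrt_of_sq_le (sq_integral_abs_le_integral_sq (hX.sub (memLp_const _)))

end Concentration

section LabelCounts

variable {m n : ℕ}

/-- The number of the vertices before `t` that choose the label `ℓ`. -/
def labelCount (ω : Fin m × Fin n → Bool) (t : Fin n) (ℓ : Fin m) : ℕ :=
  {i ∈ Finset.Iio t | ω (ℓ, i)}.card

/-- The labels that are chosen by an odd number of the vertices before `t`. -/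
def oddLabels (ω : Fin m × Fin n → Bool) (t : Fin n) : Finset (Fin m) :=
  {ℓ | Odd (labelCount ω t ℓ)}

lemma cast_labelCount (ω : Fin m × Fin n → Bool) (t : Fin n) (ℓ : Fin m) :
    (labelCount ω t ℓ : ℝ) = ∑ i ∈ Finset.Iio t, repMatrix ω ℓ i := by
  simp [labelCount, repMatrix]

lemma sum_labelCount (ω : Fin m × Fin n → Bool) (t : Fin n) :
    ∑ ℓ, (labelCount ω t ℓ : ℝ) =
      ∑ k ∈ Finset.univ ×ˢ Finset.Iio t, 1 * repMatrix ω k.1 k.2 := by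
  simp only [cast_labelCount, one_mul, Finset.sum_product]

lemma dependsOn_labelCount (t : Fin n) (ℓ : Fin m) :
    DependsOn (fun ω : Fin m × Fin n → Bool => labelCount ω t ℓ)
      (({ℓ} ×ˢ Finset.Iio t : Finset (Fin m × Fin n)) : Set (Fin m × Fin n)) := fun ω ω' h => by
  unfold labelCount
  refine congrArg Finset.card (Finset.filter_congr fun i hi => ?_)
  rw [h (ℓ, i) (by simpa using hi)]

/-- The probability that an odd number of `k` independent events of probability `q` occur. -/
def oddProb (q : ℝ) (k : ℕ) : ℝ := (1 - (1 - 2 * q) ^ k) / 2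

variable (p : unitInterval)

lemma integral_neg_one_pow_labelCount (t : Fin n) (ℓ : Fin m) :
    ∫ ω, (-1 : ℝ) ^ labelCount ω t ℓ ∂labelLaw m n p = (1 - 2 * p) ^ (t : ℕ) := by
  have h := integral_prod_labelLaw p ({ℓ} ×ˢ Finset.Iio t) fun b => if b then -1 else 1
  have hprod (ω : Fin m × Fin n → Bool) : ∏ k ∈ {ℓ} ×ˢ Finset.Iio t, (if ω k then -1 else 1 : ℝ) =
      (-1) ^ labelCount ω t ℓ := by
    rw [Finset.prod_product, Finset.prod_singleton]
    simp only [labelCount, Finset.prod_ite, Finset.prod_const, one_pow, mul_one]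
  simp only [hprod, Finset.card_product, Finset.card_singleton, one_mul, Fin.card_Iio, if_true,
    Bool.false_eq_true, if_false] at h
  rw [h]
  ring

lemma integral_indicator_odd_labelCount (t : Fin n) (ℓ : Fin m) :
    ∫ ω, (if Odd (labelCount ω t ℓ) then 1 else 0) ∂labelLaw m n p = oddProb p t := by
  have h (ω : Fin m × Fin n → Bool) : (if Odd (labelCount ω t ℓ) then (1 : ℝ) else 0) =
      (1 - (-1) ^ labelCount ω t ℓ) / 2 := by
    split_ifs with hodd
    · rw [hodd.neg_one_pow]; norm_num
    · rw [(Nat.not_odd_iff_even.1 hodd).neg_one_pow]; norm_num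
  simp only [h]
  rw [integral_div, integral_sub .of_finite .of_finite, integral_neg_one_pow_labelCount]
  simp [oddProb]

lemma integral_sum_labelCount (t : Fin n) :
    ∫ ω, ∑ ℓ, (labelCount ω t ℓ : ℝ) ∂labelLaw m n p = p * (m * t) := by
  simp only [sum_labelCount]
  rw [integral_sum_mul_repMatrix]
  simp

lemma variance_sum_labelCount_le (t : Fin n) :
    Var[fun ω => ∑ ℓ, (labelCount ω t ℓ : ℝ); labelLaw m n p] ≤ p * (m * n) := by
  have hp := p.2
  have htn : (t : ℝ) ≤ n := by exact_mod_cast t.2.le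
  simp only [sum_labelCount]
  rw [variance_sum_mul_repMatrix]
  simp only [one_pow, Finset.sum_const, Finset.card_product, Finset.card_univ, Fintype.card_fin,
    Fin.card_Iio, nsmul_eq_mul, mul_one, Nat.cast_mul]
  exact mul_le_mul (mul_le_of_le_one_right hp.1 (by linarith [hp.1])) (by gcongr) (by positivity)
    hp.1

lemma integral_abs_sum_labelCount_sub_le (t : Fin n) :
    ∫ ω, |∑ ℓ, (labelCount ω t ℓ : ℝ) - p * (m * t)| ∂labelLaw m n p ≤ √(p * (m * n)) := by
  rw [← integral_sum_labelCount]
  exact (integral_abs_sub_integral_le_sqrt_variance .of_discrete).trans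
    (Real.sqrt_le_sqrt (variance_sum_labelCount_le p t))

lemma variance_card_oddLabels_le (t : Fin n) :
    Var[fun ω => ((oddLabels ω t).card : ℝ); labelLaw m n p] ≤ m := by
  set X : Fin m → (Fin m × Fin n → Bool) → ℝ := fun ℓ ω =>
    if Odd (labelCount ω t ℓ) then 1 else 0 with hX
  have hdep (ℓ : Fin m) : DependsOn (X ℓ)
      (({ℓ} ×ˢ Finset.Iio t : Finset (Fin m × Fin n)) : Set (Fin m × Fin n)) := fun ω ω' h => by
    simp only [hX, dependsOn_labelCount t ℓ h]
  have hind (ℓ : Fin m) (_ : ℓ ∈ Finset.univ) (ℓ' : Fin m) (_ : ℓ' ∈ Finset.univ) (hne : ℓ ≠ ℓ') :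
      IndepFun (X ℓ) (X ℓ') (labelLaw m n p) :=
    indepFun_of_dependsOn _ (hdep ℓ) (hdep ℓ')
      (Finset.disjoint_product.2 (.inl (Finset.disjoint_singleton.2 hne)))
  have hvar (ℓ : Fin m) : Var[X ℓ; labelLaw m n p] ≤ 1 := by
    refine (variance_le_sq_of_bounded (a := 0) (b := 1) (.of_forall fun ω => ?_)
      (measurable_of_finite _).aemeasurable).trans (by norm_num)
    simp only [hX]
    split_ifs <;> simp
  have hsum : (fun ω => ((oddLabels ω t).card : ℝ)) = ∑ ℓ, X ℓ := by
    ext ω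
    simp [hX, oddLabels]
  rw [hsum, IndepFun.variance_sum (fun ℓ _ => .of_discrete) hind]
  simpa using Finset.sum_le_sum fun ℓ (_ : ℓ ∈ Finset.univ) => hvar ℓ

lemma integral_abs_card_oddLabels_sub_le (t : Fin n) :
    ∫ ω, |((oddLabels ω t).card : ℝ) - m * oddProb p t|
      ∂labelLaw m n p ≤ √m := by
  have hmean : ∫ ω, ((oddLabels ω t).card : ℝ) ∂labelLaw m n p =
      m * oddProb p t := by
    simp only [oddLabels, Finset.card_filter, Nat.cast_sum, Nat.cast_ite, Nat.cast_one,
      Nat.cast_zero]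
    rw [integral_finsetSum _ fun ℓ _ => .of_finite]
    simp only [integral_indicator_odd_labelCount, Finset.sum_const, Finset.card_univ,
      Fintype.card_fin, nsmul_eq_mul]
  rw [← hmean]
  exact (integral_abs_sub_integral_le_sqrt_variance .of_discrete).trans
    (Real.sqrt_le_sqrt (variance_card_oddLabels_le p t))

end LabelCounts

section AbsMomentBound

lemma absMomentBound_mono {v w : ℝ} (hv : 0 ≤ v) (hvw : v ≤ w) :
    absMomentBound v ≤ absMomentBound w := by
  have hw : 0 ≤ w := hv.trans hvw
  have hsq : v * √(3 * w + 1) ≤ w * √(3 * v + 1) := by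
    refine abs_le_of_sq_le_sq' ?_ (by positivity) |>.2
    rw [mul_pow, mul_pow, Real.sq_sqrt (by positivity), Real.sq_sqrt (by positivity)]
    nlinarith [mul_nonneg hv hw, mul_nonneg (mul_nonneg hv hw) (sub_nonneg.2 hvw)]
  rw [absMomentBound, absMomentBound, div_le_div_iff₀ (by positivity) (by positivity)]
  linarith

lemma sub_abs_sub_div_le_absMomentBound {c v w : ℝ} (hc : 0 ≤ c) (hv : 0 ≤ v) (hw : w ≤ c) :
    (w - |v - w|) / (2 * √(3 * c + 1)) ≤ absMomentBound v := by
  rcases le_total v c with hvc | hcv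
  · exact div_le_div₀ hv (by linarith [neg_abs_le (v - w)]) (by positivity) (by gcongr)
  · refine le_trans ?_ (absMomentBound_mono hc hcv)
    exact div_le_div_of_nonneg_right (by linarith [abs_nonneg (v - w)]) (by positivity)

end AbsMomentBound

section ConditionalGain

variable {m n : ℕ}

lemma weightMatrix_repMatrix_apply (ω : Fin m × Fin n → Bool) (i j : Fin n) :
    weightMatrix (repMatrix ω) i j = ∑ ℓ, repMatrix ω ℓ i * repMatrix ω ℓ j := by
  simp [weightMatrix, Matrix.mul_apply]

lemma weightMatrix_isSymm (R : Matrix (Fin m) (Fin n) ℝ) : (weightMatrix R).IsSymm := by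
  simp [weightMatrix, Matrix.IsSymm]

lemma weightMatrix_repMatrix_nonneg (ω : Fin m × Fin n → Bool) (i j : Fin n) :
    0 ≤ weightMatrix (repMatrix ω) i j := by
  rw [weightMatrix_repMatrix_apply]
  exact Finset.sum_nonneg fun ℓ _ =>
    mul_nonneg (repMatrix_mem_Icc ω ℓ i).1 (repMatrix_mem_Icc ω ℓ j).1

lemma sum_Iio_weightMatrix (ω : Fin m × Fin n → Bool) (t : Fin n) :
    ∑ i ∈ Finset.Iio t, weightMatrix (repMatrix ω) i t =
      ∑ ℓ, labelCount ω t ℓ * repMatrix ω ℓ t := by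
  simp only [weightMatrix_repMatrix_apply, cast_labelCount, Finset.sum_mul]
  exact Finset.sum_comm

/-- The sum of the colors that the Majority Cut algorithm gives to those vertices before `t` that
choose the label `ℓ`, for the order `0, 1, …, n - 1` of the vertices. -/
def labelColorSum (ε : ℝ) (b : Fin n → ℤˣ) (t : Fin n) (ω : Fin m × Fin n → Bool) (ℓ : Fin m) :
    ℝ :=
  ∑ i ∈ Finset.Iio t, repMatrix ω ℓ i * (majoritySeq (weightMatrix (repMatrix ω)) 1 ε b i : ℤ)

lemma majoritySum_weightMatrix (ω : Fin m × Fin n → Bool) (ε : ℝ) (b : Fin n → ℤˣ) (t : Fin n) :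
    majoritySum (weightMatrix (repMatrix ω)) ε b t =
      ∑ ℓ, labelColorSum ε b t ω ℓ * repMatrix ω ℓ t := by
  simp only [majoritySum, labelColorSum, weightMatrix_repMatrix_apply, Finset.sum_mul]
  rw [Finset.sum_comm]
  exact Finset.sum_congr rfl fun ℓ _ => Finset.sum_congr rfl fun i _ => by ring

lemma one_le_abs_sum_units {ι : Type*} {s : Finset ι} (hs : Odd s.card) (x : ι → ℤˣ) :
    1 ≤ |∑ i ∈ s, ((x i : ℤ) : ℝ)| := by
  have hodd : Odd (∑ i ∈ s, (x i : ℤ)) := by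
    have hmod (i : ι) : ((x i : ℤ) : ZMod 2) = 1 := by
      rcases Int.units_eq_one_or (x i) with h | h <;> rw [h] <;> rfl
    rw [← Int.not_even_iff_odd, ← ZMod.intCast_eq_zero_iff_even]
    simpa [hmod, ZMod.natCast_eq_zero_iff_even] using hs
  have hne : ∑ i ∈ s, (x i : ℤ) ≠ 0 := fun h => by simp [h] at hodd
  exact_mod_cast Int.one_le_abs hne

lemma one_le_abs_labelColorSum (ε : ℝ) (b : Fin n → ℤˣ) {t : Fin n} {ω : Fin m × Fin n → Bool}
    {ℓ : Fin m} (h : ℓ ∈ oddLabels ω t) : 1 ≤ |labelColorSum ε b t ω ℓ| := by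
  have hodd : Odd (labelCount ω t ℓ) := by simpa [oddLabels] using h
  simpa [labelColorSum, repMatrix, ← Finset.sum_filter] using one_le_abs_sum_units hodd _

/-- The entries of the column `t` of the representation matrix. -/
def columnBlock (m : ℕ) (t : Fin n) : Finset (Fin m × Fin n) := Finset.univ ×ˢ {t}

/-- The average over independent label choices of the vertex `t`: the conditional expectation given
the label choices of the other vertices. -/
def columnAverage (p : unitInterval) (t : Fin n) (f : (Fin m × Fin n → Bool) → ℝ) :
    (Fin m × Fin n → Bool) → ℝ :=
  blockAverage (fun _ => bernoulliMeasure true false p) (columnBlock m t) f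

lemma repMatrix_congr_of_ne {t i : Fin n} (hi : i ≠ t) {ω ω' : Fin m × Fin n → Bool}
    (h : ∀ k ∈ ((columnBlock m t : Set (Fin m × Fin n))ᶜ), ω k = ω' k) (ℓ : Fin m) :
    repMatrix ω ℓ i = repMatrix ω' ℓ i := by
  simp [repMatrix, h (ℓ, i) (by simpa [columnBlock] using hi.symm)]

lemma weightMatrix_congr_of_ne {t i j : Fin n} (hi : i ≠ t) (hj : j ≠ t)
    {ω ω' : Fin m × Fin n → Bool}
    (h : ∀ k ∈ ((columnBlock m t : Set (Fin m × Fin n))ᶜ), ω k = ω' k) :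
    weightMatrix (repMatrix ω) i j = weightMatrix (repMatrix ω') i j := by
  simp only [weightMatrix_repMatrix_apply, repMatrix_congr_of_ne hi h, repMatrix_congr_of_ne hj h]

lemma dependsOn_meanGain (ε : ℝ) {s t : Fin n} (hst : s < t) :
    DependsOn (fun ω : Fin m × Fin n → Bool => meanGain (weightMatrix (repMatrix ω)) ε s)
      (columnBlock m t : Set (Fin m × Fin n))ᶜ := fun ω ω' h => by
  have hW (i j : Fin n) (hi : i < t) (hj : j < t) := weightMatrix_congr_of_ne hi.ne hj.ne h
  have hweight : ∀ i ∈ Finset.Iio s, weightMatrix (repMatrix ω) i s =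
      weightMatrix (repMatrix ω') i s := fun i hi => hW i s ((Finset.mem_Iio.1 hi).trans hst) hst
  have hsum (b : Fin n → ℤˣ) : majoritySum (weightMatrix (repMatrix ω)) ε b s =
      majoritySum (weightMatrix (repMatrix ω')) ε b s :=
    Finset.sum_congr rfl fun i hi => by
      rw [hweight i hi, majoritySeq_congr hW (fun _ _ => rfl) ((Finset.mem_Iio.1 hi).trans hst)]
  simp only [meanGain, hsum, Finset.sum_congr rfl hweight]

lemma dependsOn_labelColorSum (ε : ℝ) (b : Fin n → ℤˣ) (t : Fin n) (ℓ : Fin m) :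
    DependsOn (fun ω : Fin m × Fin n → Bool => labelColorSum ε b t ω ℓ)
      (columnBlock m t : Set (Fin m × Fin n))ᶜ := fun ω ω' h =>
  Finset.sum_congr rfl fun i hi => by
    have hi := Finset.mem_Iio.1 hi
    rw [repMatrix_congr_of_ne hi.ne h,
      majoritySeq_congr (fun i j hi hj => weightMatrix_congr_of_ne hi.ne hj.ne h)
        (fun _ _ => rfl) hi]

lemma dependsOn_cast_labelCount (t : Fin n) (ℓ : Fin m) :
    DependsOn (fun ω : Fin m × Fin n → Bool => (labelCount ω t ℓ : ℝ))
      (columnBlock m t : Set (Fin m × Fin n))ᶜ := fun ω ω' h => by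
  simp only [cast_labelCount]
  exact Finset.sum_congr rfl fun i hi => repMatrix_congr_of_ne (Finset.mem_Iio.1 hi).ne h ℓ

variable (p : unitInterval)

lemma columnAverage_comp_sum_mul {t : Fin n} {y : (Fin m × Fin n → Bool) → Fin m → ℝ}
    (hy : ∀ ℓ, DependsOn (fun ω => y ω ℓ) (columnBlock m t : Set (Fin m × Fin n))ᶜ) (φ : ℝ → ℝ)
    (ω : Fin m × Fin n → Bool) :
    columnAverage p t (fun ω => φ (∑ ℓ, y ω ℓ * repMatrix ω ℓ t)) ω =
      ∫ η, φ (∑ ℓ, y ω ℓ * repMatrix η ℓ t) ∂labelLaw m n p := by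
  have hrep (η : Fin m × Fin n → Bool) (ℓ : Fin m) :
      repMatrix ((columnBlock m t).piecewise η ω) ℓ t = repMatrix η ℓ t := by
    simp [repMatrix, columnBlock]
  simp only [columnAverage, blockAverage, fun η ℓ => apply_piecewise_of_dependsOn (hy ℓ) η ω, hrep]
  rfl

lemma sum_columnBlock (t : Fin n) (y : Fin m → ℝ) (ω : Fin m × Fin n → Bool) :
    ∑ k ∈ columnBlock m t, y k.1 * repMatrix ω k.1 k.2 = ∑ ℓ, y ℓ * repMatrix ω ℓ t := by
  simp [columnBlock]

lemma columnAverage_sum_Iio_weightMatrix (t : Fin n) (ω : Fin m × Fin n → Bool) :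
    columnAverage p t (fun ω => ∑ i ∈ Finset.Iio t, weightMatrix (repMatrix ω) i t) ω =
      p * ∑ ℓ, (labelCount ω t ℓ : ℝ) := by
  simp only [sum_Iio_weightMatrix]
  rw [columnAverage_comp_sum_mul p (dependsOn_cast_labelCount t) (fun x => x)]
  simp only [← sum_columnBlock, integral_sum_mul_repMatrix p _ fun k => (labelCount ω t k.1 : ℝ)]
  simp [columnBlock]

lemma absMomentBound_le_columnAverage_abs_majoritySum (ε : ℝ) (b : Fin n → ℤˣ) (t : Fin n)
    (ω : Fin m × Fin n → Bool) :
    absMomentBound (2 * ((oddLabels ω t).card * (p * (1 - p)))) ≤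
      columnAverage p t (fun ω => |majoritySum (weightMatrix (repMatrix ω)) ε b t|) ω := by
  simp only [majoritySum_weightMatrix]
  rw [columnAverage_comp_sum_mul p (dependsOn_labelColorSum ε b t) fun x => |x|]
  have hind : iIndepFun (fun ℓ η => repMatrix η ℓ t) (labelLaw m n p) :=
    (iIndepFun_repMatrix p).precomp (Prod.mk_left_injective t)
  simpa only [variance_repMatrix, Finset.sum_const, nsmul_eq_mul] using
    absMomentBound_le_integral_abs_sum_mul hind (fun ℓ => measurable_of_finite _)
      (fun ℓ η => repMatrix_mem_Icc η ℓ t) fun ℓ hℓ => one_le_abs_labelColorSum ε b hℓ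

lemma columnAverage_add (t : Fin n) (f g : (Fin m × Fin n → Bool) → ℝ)
    (ω : Fin m × Fin n → Bool) : columnAverage p t (fun ω => f ω + g ω) ω =
      columnAverage p t f ω + columnAverage p t g ω :=
  integral_add .of_finite .of_finite

lemma columnAverage_expect {β : Type*} [Fintype β] (t : Fin n)
    (f : β → (Fin m × Fin n → Bool) → ℝ) (ω : Fin m × Fin n → Bool) :
    columnAverage p t (fun ω => 𝔼 b, f b ω) ω = 𝔼 b, columnAverage p t (f b) ω := by
  simp only [columnAverage, blockAverage, Fintype.expect_eq_sum_div_card]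
  rw [integral_div, integral_finsetSum _ fun b _ => .of_finite]

lemma le_columnAverage_meanGain (ε : ℝ) (t : Fin n) (ω : Fin m × Fin n → Bool) :
    p * ∑ ℓ, (labelCount ω t ℓ : ℝ) + (if (t : ℝ) + 1 ≤ ε * n then 0 else
      absMomentBound (2 * ((oddLabels ω t).card * (p * (1 - p))))) ≤
    columnAverage p t (fun ω => meanGain (weightMatrix (repMatrix ω)) ε t) ω := by
  simp only [meanGain]
  rw [columnAverage_add, columnAverage_sum_Iio_weightMatrix]
  gcongr
  split_ifs with ht
  · simp [columnAverage, blockAverage]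
  · rw [columnAverage_expect]
    exact Finset.le_expect Finset.univ_nonempty fun b _ =>
      absMomentBound_le_columnAverage_abs_majoritySum p ε b t ω

end ConditionalGain

section GainDeviation

variable {m n : ℕ} (p : unitInterval)

lemma integral_columnAverage (t : Fin n) (f : (Fin m × Fin n → Bool) → ℝ) :
    ∫ ω, columnAverage p t f ω ∂labelLaw m n p = ∫ ω, f ω ∂labelLaw m n p :=
  integral_blockAverage _ f

lemma integral_total_weight :
    ∫ ω, (∑ i, ∑ j, if i ≠ j then weightMatrix (repMatrix ω) i j else 0) ∂labelLaw m n p =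
      2 * ∑ t : Fin n, (p * (p * (m * t)) : ℝ) := by
  simp only [fun ω : Fin m × Fin n → Bool => sum_ite_ne_eq_two_mul_sum_Iio
    fun i j => (weightMatrix_isSymm (repMatrix ω)).apply j i]
  rw [integral_const_mul, integral_finsetSum _ fun t _ => .of_finite]
  refine congrArg _ (Finset.sum_congr rfl fun t _ => ?_)
  rw [← integral_columnAverage p t]
  simp only [columnAverage_sum_Iio_weightMatrix, integral_const_mul, integral_sum_labelCount]

lemma integral_labelCount_sq_le (t : Fin n) (ℓ : Fin m) :
    ∫ ω, (labelCount ω t ℓ : ℝ) ^ 2 ∂labelLaw m n p ≤ p * t + (p * t) ^ 2 := by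
  have h := integral_sum_mul_repMatrix_sq_le p (({ℓ} : Finset (Fin m)) ×ˢ Finset.Iio t) fun _ => 1
  simpa [← cast_labelCount, Finset.sum_product, mul_pow] using h

lemma integral_sum_labelCount_sq_le (t : Fin n) :
    ∫ ω, (∑ ℓ : Fin m, (labelCount ω t ℓ : ℝ)) ^ 2 ∂labelLaw m n p ≤
      p * (m * t) + (p * (m * t)) ^ 2 := by
  simp only [sum_labelCount]
  refine (integral_sum_mul_repMatrix_sq_le p _ _).trans_eq ?_
  simp [mul_pow]

lemma integral_sum_Iio_weightMatrix_sq_le (t : Fin n) :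
    ∫ ω : Fin m × Fin n → Bool, (∑ i ∈ Finset.Iio t, weightMatrix (repMatrix ω) i t) ^ 2
        ∂labelLaw m n p ≤
      p * (m * (p * t + (p * t) ^ 2)) + p ^ 2 * (p * (m * t) + (p * (m * t)) ^ 2) := by
  have hp : (0 : ℝ) ≤ p := p.2.1
  have havg (ω : Fin m × Fin n → Bool) :
      columnAverage p t (fun ω => (∑ i ∈ Finset.Iio t, weightMatrix (repMatrix ω) i t) ^ 2) ω ≤
        p * ∑ ℓ, (labelCount ω t ℓ : ℝ) ^ 2 + p ^ 2 * (∑ ℓ, (labelCount ω t ℓ : ℝ)) ^ 2 := by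
    simp only [sum_Iio_weightMatrix]
    rw [columnAverage_comp_sum_mul p (dependsOn_cast_labelCount t) (fun x => x ^ 2)]
    simp only [← sum_columnBlock]
    refine (integral_sum_mul_repMatrix_sq_le p _ fun k => (labelCount ω t k.1 : ℝ)).trans_eq ?_
    simp [columnBlock]
  rw [← integral_columnAverage p t]
  refine (integral_mono .of_finite .of_finite havg).trans ?_
  rw [integral_add .of_finite .of_finite, integral_const_mul, integral_const_mul,
    integral_finsetSum _ fun ℓ _ => .of_finite]
  gcongr
  · exact (Finset.sum_le_sum fun ℓ _ => integral_labelCount_sq_le p t ℓ).trans_eq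
      (by simp [mul_add])
  · exact integral_sum_labelCount_sq_le p t

/-- A lower bound for the expected excess of the gain of the Majority Cut algorithm at time `t` over
that of a random coloring, with the number of labels chosen an odd number of times before `t`
replaced by its expectation. -/
def excessGain (m : ℕ) {n : ℕ} (p : unitInterval) (ε : ℝ) (t : Fin n) : ℝ :=
  if (t : ℝ) + 1 ≤ ε * n then 0
  else m * oddProb p t * (p * (1 - p)) / √(3 * (m * p) + 1)

/-- An upper bound for the deviation of the total gain of the Majority Cut algorithm from its
typical value: a martingale part, and for every vertex the deviations of the number of label
choices made before it and of the number of labels chosen an odd number of times. -/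
def gainDeviation (p : unitInterval) (ε : ℝ) (ω : Fin m × Fin n → Bool) : ℝ :=
  |∑ t, (meanGain (weightMatrix (repMatrix ω)) ε t -
      columnAverage p t (fun ω => meanGain (weightMatrix (repMatrix ω)) ε t) ω)| +
    ∑ t, p * (|∑ ℓ, (labelCount ω t ℓ : ℝ) - p * (m * t)| +
      |(oddLabels ω t).card - m * oddProb p t|)

lemma one_sub_mul_two_mul_oddProb_le_one (k : ℕ) :
    (1 - p : ℝ) * (2 * oddProb (p : ℝ) k) ≤ 1 := by
  obtain ⟨hp0, hp1⟩ := p.2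
  have hpow : |(1 - 2 * (p : ℝ)) ^ k| ≤ 1 := by
    rw [abs_pow]
    exact pow_le_one₀ (abs_nonneg _) (abs_le.2 ⟨by linarith, by linarith⟩)
  rw [oddProb]
  rcases le_total (p : ℝ) (1 / 2) with hp | hp
  · have := pow_nonneg (by linarith : 0 ≤ 1 - 2 * (p : ℝ)) k
    exact mul_le_one₀ (by linarith) (by linarith [abs_le.1 hpow]) (by linarith)
  · nlinarith [abs_le.1 hpow]

lemma excessGain_sub_le (ε : ℝ) (t : Fin n) (N : ℝ) (hN : 0 ≤ N) :
    excessGain m p ε t - p * |N - m * oddProb p t| ≤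
      if (t : ℝ) + 1 ≤ ε * n then 0 else absMomentBound (2 * (N * (p * (1 - p)))) := by
  obtain ⟨hp0, hp1⟩ := p.2
  have hvar : (0 : ℝ) ≤ p * (1 - p) := mul_nonneg hp0 (by linarith)
  rw [excessGain]
  split_ifs
  · linarith [mul_nonneg hp0 (abs_nonneg (N - m * oddProb p t))]
  set w : ℝ := 2 * (m * oddProb p t * (p * (1 - p))) with hw
  have hwc : w ≤ m * p := by
    have := mul_le_mul_of_nonneg_left (one_sub_mul_two_mul_oddProb_le_one p t)
      (by positivity : (0 : ℝ) ≤ m * p)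
    linarith
  refine le_trans ?_ (sub_abs_sub_div_le_absMomentBound (by positivity) (by positivity) hwc)
  have habs : |2 * (N * (p * (1 - p))) - w| = 2 * (p * (1 - p) * |N - m * oddProb p t|) := by
    rw [hw, ← mul_sub, ← sub_mul, abs_mul, abs_mul, abs_of_nonneg hvar, abs_two]
    ring
  have hsqrt : 1 ≤ √(3 * (m * p) + 1 : ℝ) :=
    Real.one_le_sqrt.2 (le_add_of_nonneg_left (by positivity))
  have hdiv : p * (1 - p) * |N - m * oddProb p t| / √(3 * (m * p) + 1 : ℝ) ≤
      p * |N - m * oddProb p t| :=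
    (div_le_self (by positivity) hsqrt).trans (by gcongr; nlinarith)
  rw [habs, ← mul_sub, mul_div_mul_left _ _ two_ne_zero, sub_div]
  exact sub_le_sub_left hdiv _

lemma le_majorityExpectedWeight (ε : ℝ) (ω : Fin m × Fin n → Bool) :
    1 / 4 * ∫ ω', (∑ i, ∑ j, if i ≠ j then weightMatrix (repMatrix ω') i j else 0)
        ∂labelLaw m n p +
      1 / 2 * (∑ t : Fin n, excessGain m p ε t - gainDeviation p ε ω) ≤
    majorityExpectedWeight (weightMatrix (repMatrix ω)) 1 ε := by
  have hterm (t : Fin n) : (p * (p * (m * t)) : ℝ) + excessGain m p ε t -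
      p * (|∑ ℓ, (labelCount ω t ℓ : ℝ) - p * (m * t)| +
        |(oddLabels ω t).card - m * oddProb p t|) ≤
      columnAverage p t (fun ω => meanGain (weightMatrix (repMatrix ω)) ε t) ω := by
    refine le_trans ?_ (le_columnAverage_meanGain p ε t ω)
    have hcount := mul_le_mul_of_nonneg_left
      (neg_abs_le (∑ ℓ, (labelCount ω t ℓ : ℝ) - p * (m * t))) p.2.1
    have hodd := excessGain_sub_le (m := m) p ε t _ (oddLabels ω t).card.cast_nonneg
    linarith
  have hsum := Finset.sum_le_sum fun t (_ : t ∈ Finset.univ) => hterm t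
  have habs := neg_abs_le (∑ t, (meanGain (weightMatrix (repMatrix ω)) ε t -
      columnAverage p t (fun ω => meanGain (weightMatrix (repMatrix ω)) ε t) ω))
  simp only [Finset.sum_sub_distrib, Finset.sum_add_distrib] at hsum habs
  rw [majorityExpectedWeight_one_eq (weightMatrix_isSymm _), integral_total_weight, gainDeviation]
  simp only [Finset.sum_sub_distrib]
  linarith

lemma integral_gainDeviation_le (ε : ℝ) :
    ∫ ω, gainDeviation p ε ω ∂labelLaw m n p ≤
      √(∑ t : Fin n, 4 * ∫ ω : Fin m × Fin n → Bool,
          (∑ i ∈ Finset.Iio t, weightMatrix (repMatrix ω) i t) ^ 2 ∂labelLaw m n p) +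
        n * (p * (√(p * (m * n)) + √m)) := by
  have hp : (0 : ℝ) ≤ p := p.2.1
  have hgain (t : Fin n) :
      ∫ ω : Fin m × Fin n → Bool, meanGain (weightMatrix (repMatrix ω)) ε t ^ 2
          ∂labelLaw m n p ≤
        4 * ∫ ω : Fin m × Fin n → Bool,
          (∑ i ∈ Finset.Iio t, weightMatrix (repMatrix ω) i t) ^ 2 ∂labelLaw m n p := by
    rw [← integral_const_mul]
    refine integral_mono .of_finite .of_finite fun ω => ?_
    simpa [mul_pow, show (2 : ℝ) ^ 2 = 4 by norm_num] using sq_le_sq.2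
      ((abs_meanGain_le (weightMatrix_repMatrix_nonneg ω) ε t).trans (le_abs_self _))
  simp only [gainDeviation]
  rw [integral_add .of_finite .of_finite, integral_finsetSum _ fun t _ => .of_finite]
  gcongr
  · refine Real.le_sqrt_of_sq_le ((sq_integral_abs_le_integral_sq .of_discrete).trans ?_)
    exact (integral_sum_sub_blockAverage_sq_le fun s t hst => dependsOn_meanGain ε hst).trans
      (Finset.sum_le_sum fun t _ => hgain t)
  · refine (Finset.sum_le_card_nsmul _ _ (p * (√(p * (m * n)) + √m)) fun t _ => ?_).trans_eq
      (by simp)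
    rw [integral_const_mul, integral_add .of_finite .of_finite]
    gcongr
    · exact integral_abs_sum_labelCount_sub_le p t
    · exact integral_abs_card_oddLabels_sub_le p t

lemma measureReal_le_majorityExpectedWeight (σ : Equiv.Perm (Fin n)) (ε a : ℝ) :
    (labelLaw m n p).real {ω | a ≤ majorityExpectedWeight (weightMatrix (repMatrix ω)) σ ε} =
      (labelLaw m n p).real {ω | a ≤ majorityExpectedWeight (weightMatrix (repMatrix ω)) 1 ε} := by
  have hset : (fun ω : Fin m × Fin n → Bool => fun k : Fin m × Fin n => ω (k.1, σ k.2)) ⁻¹'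
      {ω | a ≤ majorityExpectedWeight (weightMatrix (repMatrix ω)) 1 ε} =
      {ω | a ≤ majorityExpectedWeight (weightMatrix (repMatrix ω)) σ ε} := by
    simp only [← majorityExpectedWeight_submatrix _ σ]
    rfl
  rw [← hset, (measurePreserving_comp_prodMap p σ).measureReal_preimage
    (Set.toFinite _).measurableSet.nullMeasurableSet]

end GainDeviation

section SparseRegime

variable {n : ℕ}

lemma coe_sparseProb {c : ℝ} (hc : 0 ≤ c) (hn : c ≤ n) : (sparseProb c n : ℝ) = c / n := by
  rw [sparseProb, Set.projIcc_of_mem zero_le_one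
    ⟨by positivity, div_le_one_of_le₀ hn (by positivity)⟩]

lemma two_mul_sum_fin_le_sq (n : ℕ) : 2 * ∑ t : Fin n, (t : ℝ) ≤ n ^ 2 := by
  rw [Fin.sum_univ_eq_sum_range fun i => (i : ℝ)]
  have hgauss : 2 * ∑ i ∈ Finset.range n, i ≤ n ^ 2 := by
    rw [mul_comm, Finset.sum_range_id_mul_two, sq]
    exact Nat.mul_le_mul_left _ (Nat.sub_le _ _)
  simpa using (Nat.cast_le (α := ℝ)).2 hgauss

lemma integral_total_weight_le (m n : ℕ) (p : unitInterval) :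
    ∫ ω, (∑ i, ∑ j, if i ≠ j then weightMatrix (repMatrix ω) i j else 0) ∂labelLaw m n p ≤
      m * (p * n) ^ 2 := by
  rw [integral_total_weight]
  calc 2 * ∑ t : Fin n, (p * (p * (m * t)) : ℝ)
      = m * p ^ 2 * (2 * ∑ t : Fin n, (t : ℝ)) := by
        simp only [Finset.mul_sum]
        exact Finset.sum_congr rfl fun t _ => by ring
    _ ≤ m * p ^ 2 * n ^ 2 := by gcongr; exact two_mul_sum_fin_le_sq n
    _ = m * (p * n) ^ 2 := by ring

lemma card_filter_add_one_le {a : ℝ} (ha : 0 ≤ a) :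
    ((Finset.univ.filter fun t : Fin n => (t : ℝ) + 1 ≤ a).card : ℝ) ≤ a := by
  refine le_trans (Nat.cast_le.2 ?_) (Nat.floor_le ha)
  rw [← Finset.card_map Fin.valEmbedding, ← Finset.card_range ⌊a⌋₊]
  refine Finset.card_le_card fun i hi => ?_
  obtain ⟨t, ht, rfl⟩ := Finset.mem_map.1 hi
  rw [Finset.mem_range, ← Nat.succ_le_iff, Nat.le_floor_iff ha]
  exact_mod_cast (Finset.mem_filter.1 ht).2

lemma one_sub_mul_sum_pow_le {r : ℝ} (hr : 0 ≤ r) : (1 - r) * ∑ t : Fin n, r ^ (t : ℕ) ≤ 1 := by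
  rw [Fin.sum_univ_eq_sum_range fun i => r ^ i, mul_neg_geom_sum]
  linarith [pow_nonneg hr n]

variable {c : ℝ} {p : unitInterval}

lemma integral_sum_Iio_weightMatrix_sq_le_of_mul_eq (hc : 1 ≤ c) (hp : (n * p : ℝ) = c)
    (t : Fin n) :
    ∫ ω : Fin n × Fin n → Bool, (∑ i ∈ Finset.Iio t, weightMatrix (repMatrix ω) i t) ^ 2
        ∂labelLaw n n p ≤ (c + c ^ 2) ^ 2 := by
  obtain ⟨hp0, hp1⟩ := p.2
  have ht : (p * t : ℝ) ≤ c := by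
    rw [← hp, mul_comm]
    gcongr
    exact t.2.le
  calc _ ≤ (p * (n * (p * t + (p * t) ^ 2)) + p ^ 2 * (p * (n * t) + (p * (n * t)) ^ 2) : ℝ) :=
        integral_sum_Iio_weightMatrix_sq_le p t
    _ = c * (p * t + (p * t) ^ 2) + p * c * (p * t) + c ^ 2 * (p * t) ^ 2 := by rw [← hp]; ring
    _ ≤ c * (c + c ^ 2) + 1 * c * c + c ^ 2 * c ^ 2 := by gcongr
    _ ≤ (c + c ^ 2) ^ 2 := by nlinarith [mul_nonneg (sq_nonneg c) (sub_nonneg.2 hc)]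

lemma integral_gainDeviation_le_of_mul_eq (hc : 1 ≤ c) (hp : (n * p : ℝ) = c) (ε : ℝ) :
    ∫ ω : Fin n × Fin n → Bool, gainDeviation p ε ω ∂labelLaw n n p ≤ 3 * (c * (c + 1)) * √n := by
  have hmartingale : √(∑ t : Fin n, 4 * ∫ ω : Fin n × Fin n → Bool,
      (∑ i ∈ Finset.Iio t, weightMatrix (repMatrix ω) i t) ^ 2 ∂labelLaw n n p) ≤
      2 * (c + c ^ 2) * √n := by
    refine Real.sqrt_le_iff.2 ⟨by positivity, ?_⟩
    refine (Finset.sum_le_card_nsmul _ _ (4 * (c + c ^ 2) ^ 2) fun t _ => ?_).trans_eq ?_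
    · gcongr
      exact integral_sum_Iio_weightMatrix_sq_le_of_mul_eq hc hp t
    · simp only [Finset.card_univ, Fintype.card_fin, nsmul_eq_mul, mul_pow,
        Real.sq_sqrt n.cast_nonneg]
      ring
  have hsqrt : √(p * (n * n)) ≤ c * √n := by
    rw [← mul_assoc, mul_comm (p : ℝ), hp, Real.sqrt_mul (by linarith)]
    gcongr
    exact Real.sqrt_le_iff.2 ⟨by linarith, le_self_pow₀ hc two_ne_zero⟩
  calc _ ≤ _ := integral_gainDeviation_le p ε
    _ ≤ 2 * (c + c ^ 2) * √n + n * (p * (c * √n + √n)) := by gcongr; exact p.2.1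
    _ = 3 * (c * (c + 1)) * √n := by rw [← mul_assoc (n : ℝ), hp]; ring

lemma mul_one_sub_pow_sub_le_excessGain (m : ℕ) {ε a : ℝ} (hp : (p : ℝ) ≤ 1 / 2)
    (hε : ε * n ≤ a) (t : Fin n) :
    (m * p * (1 - p) / √(3 * (m * p) + 1) / 2 : ℝ) *
        (1 - (1 - 2 * p) ^ (t : ℕ) - if (t : ℝ) + 1 ≤ a then 1 else 0) ≤
      excessGain m p ε t := by
  have hp0 : (0 : ℝ) ≤ p := p.2.1
  have hpow0 : 0 ≤ (1 - 2 * p : ℝ) ^ (t : ℕ) := pow_nonneg (by linarith) _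
  have hK : (0 : ℝ) ≤ m * p * (1 - p) / √(3 * (m * p) + 1) / 2 := by
    have := sub_nonneg.2 p.2.2
    positivity
  rw [excessGain]
  by_cases hearly : (t : ℝ) + 1 ≤ ε * n
  · rw [if_pos hearly, if_pos (hearly.trans hε)]
    exact mul_nonpos_of_nonneg_of_nonpos hK (by linarith)
  · rw [if_neg hearly]
    calc _ ≤ (m * p * (1 - p) / √(3 * (m * p) + 1) / 2 : ℝ) * (1 - (1 - 2 * p) ^ (t : ℕ)) := by
          refine mul_le_mul_of_nonneg_left (sub_le_self _ ?_) hK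
          positivity
      _ = m * oddProb p t * (p * (1 - p)) / √(3 * (m * p) + 1) := by
          rw [oddProb]
          ring

lemma le_sum_one_sub_pow_sub {q a : ℝ} (hq0 : 0 < q) (hq : q ≤ 1 / 2) (ha : 0 ≤ a) :
    n - 1 / (2 * q) - a ≤
      ∑ t : Fin n, (1 - (1 - 2 * q) ^ (t : ℕ) - if (t : ℝ) + 1 ≤ a then 1 else 0) := by
  have hgeom : ∑ t : Fin n, (1 - 2 * q) ^ (t : ℕ) ≤ 1 / (2 * q) := by
    rw [le_div_iff₀' (by positivity)]
    simpa using one_sub_mul_sum_pow_le (n := n) (by linarith : 0 ≤ 1 - 2 * q)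
  have hearly := card_filter_add_one_le (n := n) ha
  simp only [Finset.sum_sub_distrib, Finset.sum_const, Finset.card_univ, Fintype.card_fin,
    nsmul_eq_mul, mul_one, Finset.sum_boole]
  linarith

lemma le_sum_excessGain {ε : ℝ} (hc : 10 ≤ c) (hp : (n * p : ℝ) = c) (hp1 : (p : ℝ) ≤ 1 / 100)
    (hε : ε ≤ 1 / 10) :
    0.42 * (c / √(3 * c + 1)) * n ≤ ∑ t : Fin n, excessGain n p ε t := by
  have hp0 : (0 : ℝ) < p := pos_of_mul_pos_right (by linarith : (0 : ℝ) < n * p) n.cast_nonneg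
  have hrecip : 1 / (2 * p : ℝ) ≤ n / 20 := by
    rw [div_le_div_iff₀ (by positivity) (by norm_num)]
    linarith
  have hx : 0 ≤ c / √(3 * c + 1) * n := by positivity
  have hK : 0.99 * (c / √(3 * c + 1)) / 2 ≤ c * (1 - p) / √(3 * c + 1) / 2 := by
    rw [mul_comm c, mul_div_assoc (1 - p : ℝ)]
    linarith [mul_le_mul_of_nonneg_right (by linarith : (0.99 : ℝ) ≤ 1 - p)
      (by positivity : 0 ≤ c / √(3 * c + 1))]
  calc 0.42 * (c / √(3 * c + 1)) * n
      ≤ 0.99 * (c / √(3 * c + 1)) / 2 * (n - n / 20 - n / 10) := by linarith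
    _ ≤ c * (1 - p) / √(3 * c + 1) / 2 * (n - 1 / (2 * p) - n / 10) :=
        mul_le_mul hK (by linarith) (by linarith) (le_trans (by positivity) hK)
    _ ≤ c * (1 - p) / √(3 * c + 1) / 2 *
        ∑ t : Fin n, (1 - (1 - 2 * (p : ℝ)) ^ (t : ℕ) -
          if (t : ℝ) + 1 ≤ n / 10 then 1 else 0) :=
        mul_le_mul_of_nonneg_left (le_sum_one_sub_pow_sub hp0 (by linarith) (by positivity))
          (le_trans (by positivity) hK)
    _ ≤ ∑ t : Fin n, excessGain n p ε t := by
        rw [Finset.mul_sum, ← hp]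
        exact Finset.sum_le_sum fun t _ => mul_one_sub_pow_sub_le_excessGain n (by linarith)
          (by linarith [mul_le_mul_of_nonneg_right hε n.cast_nonneg]) t

lemma sqrt_mul_add_le (hc : 10 ≤ c) :
    √(16 / (27 * Real.pi * c ^ 3)) * (c ^ 2 / 4) + 1 / 50 ≤ 0.21 * (c / √(3 * c + 1)) := by
  set r := √c
  have hr2 : r ^ 2 = c := Real.sq_sqrt (by linarith)
  have hr3 : 3 ≤ r := Real.le_sqrt_of_sq_le (by linarith)
  have hbeta : √(16 / (27 * Real.pi * c ^ 3)) ≤ 0.4348 / r ^ 3 := by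
    refine Real.sqrt_le_iff.2 ⟨by positivity, ?_⟩
    rw [div_pow, ← pow_mul, mul_comm 3 2, pow_mul, hr2,
      div_le_div_iff₀ (by positivity) (by positivity)]
    have hpi := Real.pi_gt_d2
    have hc3 : 0 < c ^ 3 := by positivity
    nlinarith
  have hsqrt : √(3 * c + 1) ≤ 1.761 * r := by
    refine Real.sqrt_le_iff.2 ⟨by positivity, ?_⟩
    rw [mul_pow, hr2]
    linarith
  calc √(16 / (27 * Real.pi * c ^ 3)) * (c ^ 2 / 4) + 1 / 50
      ≤ 0.4348 / r ^ 3 * (c ^ 2 / 4) + 1 / 50 := by gcongr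
    _ = 0.1087 * r + 1 / 50 := by rw [← hr2]; field_simp; ring
    _ ≤ 0.21 / 1.761 * r := by linarith
    _ = 0.21 * (c / (1.761 * r)) := by rw [← hr2]; field_simp
    _ ≤ 0.21 * (c / √(3 * c + 1)) := by gcongr

lemma le_majorityExpectedWeight_of_gainDeviation_le {ε : ℝ} (hc : 10 ≤ c)
    (hp : (n * p : ℝ) = c) (hp1 : (p : ℝ) ≤ 1 / 100) (hε : ε ≤ 1 / 10)
    {ω : Fin n × Fin n → Bool} (hω : gainDeviation p ε ω ≤ n / 25) :
    (1 + √(16 / (27 * Real.pi * c ^ 3))) * (1 / 4 * ∫ ω', (∑ i, ∑ j,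
        if i ≠ j then weightMatrix (repMatrix ω') i j else 0) ∂labelLaw n n p) ≤
      majorityExpectedWeight (weightMatrix (repMatrix ω)) 1 ε := by
  refine le_trans ?_ (le_majorityExpectedWeight p ε ω)
  rw [one_add_mul]
  refine add_le_add_right ?_ _
  have htotal := integral_total_weight_le n n p
  rw [mul_comm (p : ℝ), hp] at htotal
  calc _ ≤ √(16 / (27 * Real.pi * c ^ 3)) * (1 / 4 * (n * c ^ 2)) := by gcongr
    _ = √(16 / (27 * Real.pi * c ^ 3)) * (c ^ 2 / 4) * n := by ring
    _ ≤ (0.21 * (c / √(3 * c + 1)) - 1 / 50) * n := by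
        gcongr
        linarith [sqrt_mul_add_le hc]
    _ = 1 / 2 * (0.42 * (c / √(3 * c + 1)) * n - n / 25) := by ring
    _ ≤ 1 / 2 * (∑ t : Fin n, excessGain n p ε t - gainDeviation p ε ω) := by
        refine mul_le_mul_of_nonneg_left (sub_le_sub ?_ hω) one_half_pos.le
        exact le_sum_excessGain hc hp hp1 hε

lemma one_sub_integral_div_le_measureReal {Ω : Type*} [MeasurableSpace Ω] {μ : Measure Ω}
    [IsProbabilityMeasure μ] {f : Ω → ℝ} (hf : 0 ≤ f) (hint : Integrable f μ) {a : ℝ} (ha : 0 < a)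
    {s : Set Ω} (hs : ∀ ω, f ω ≤ a → ω ∈ s) : 1 - (∫ ω, f ω ∂μ) / a ≤ μ.real s := by
  have hmarkov : μ.real {ω | a ≤ f ω} ≤ (∫ ω, f ω ∂μ) / a := by
    rw [le_div_iff₀ ha, mul_comm]
    exact mul_meas_ge_le_integral_of_nonneg (.of_forall hf) hint a
  have hcover : s ∪ {ω | a ≤ f ω} = Set.univ :=
    Set.eq_univ_of_forall fun ω => (le_total (f ω) a).imp (hs ω) id
  have hunion := measureReal_union_le (μ := μ) s {ω | a ≤ f ω}
  rw [hcover, probReal_univ] at hunion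
  linarith

lemma gainDeviation_nonneg {m : ℕ} (p : unitInterval) (ε : ℝ) (ω : Fin m × Fin n → Bool) :
    0 ≤ gainDeviation p ε ω :=
  add_nonneg (abs_nonneg _) (Finset.sum_nonneg fun _ _ => mul_nonneg p.2.1 (by positivity))

lemma one_sub_div_sqrt_le_measureReal {ε : ℝ} (hc : 10 ≤ c) (hn : 100 * c ≤ n) (hε : ε ≤ 1 / 10)
    (σ : Equiv.Perm (Fin n)) :
    1 - 75 * (c * (c + 1)) / √n ≤ (labelLaw n n (sparseProb c n)).real
      {ω | (1 + √(16 / (27 * Real.pi * c ^ 3))) * (1 / 4 * ∫ ω', (∑ i, ∑ j,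
            if i ≠ j then weightMatrix (repMatrix ω') i j else 0)
            ∂(labelLaw n n (sparseProb c n))) ≤
          majorityExpectedWeight (weightMatrix (repMatrix ω)) σ ε} := by
  have hn0 : (0 : ℝ) < n := by linarith
  have hcoe := coe_sparseProb (by linarith : 0 ≤ c) (by linarith : c ≤ n)
  have hp : (n * sparseProb c n : ℝ) = c := by rw [hcoe, mul_div_cancel₀ _ hn0.ne']
  have hp1 : (sparseProb c n : ℝ) ≤ 1 / 100 := by
    rw [hcoe, div_le_iff₀ hn0]
    linarith
  rw [measureReal_le_majorityExpectedWeight]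
  refine le_trans ?_ (one_sub_integral_div_le_measureReal
    (gainDeviation_nonneg (sparseProb c n) ε) .of_finite (by positivity : (0 : ℝ) < n / 25)
    fun ω => le_majorityExpectedWeight_of_gainDeviation_le hc hp hp1 hε)
  refine sub_le_sub_left ?_ 1
  calc _ ≤ 3 * (c * (c + 1)) * √n / (n / 25) := by
        gcongr
        exact integral_gainDeviation_le_of_mul_eq (by linarith) hp ε
    _ = 75 * (c * (c + 1)) / √n := by
        nth_rw 2 [← Real.sq_sqrt hn0.le]
        field_simp
        norm_num

lemma integral_randomCutExpectedWeight (m n : ℕ) (p : unitInterval) :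
    ∫ ω, randomCutExpectedWeight (weightMatrix (repMatrix ω)) ∂(labelLaw m n p) =
      1 / 4 * ∫ ω, (∑ i, ∑ j, if i ≠ j then weightMatrix (repMatrix ω) i j else 0)
        ∂(labelLaw m n p) := by
  simp only [randomCutExpectedWeight_eq, integral_const_mul]

end SparseRegime

theorem mainTheorem3_general {c ε : ℝ} (hc : 10 ≤ c) (hε : ε ≤ 1 / 10)
    (σ : (n : ℕ) → Equiv.Perm (Fin n)) :
    Tendsto
      (fun n : ℕ => (labelLaw n n (sparseProb c n)).real
        {ω | (1 + √(16 / (27 * Real.pi * c ^ 3))) * (1 / 4 * ∫ ω', (∑ i, ∑ j,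
                if i ≠ j then weightMatrix (repMatrix ω') i j else 0)
                ∂(labelLaw n n (sparseProb c n))) ≤
            majorityExpectedWeight (weightMatrix (repMatrix ω)) (σ n) ε})
      atTop (𝓝 1) := by
  have hlim : Tendsto (fun n : ℕ => 1 - 75 * (c * (c + 1)) / √n) atTop (𝓝 1) := by
    simpa using ((Real.tendsto_sqrt_atTop.comp tendsto_natCast_atTop_atTop).const_div_atTop
      (75 * (c * (c + 1)))).const_sub 1
  refine tendsto_of_tendsto_of_tendsto_of_le_of_le' hlim tendsto_const_nhds ?_
    (.of_forall fun n => measureReal_le_one)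
  filter_upwards [tendsto_natCast_atTop_atTop.eventually_ge_atTop (100 * c)] with n hn
  exact one_sub_div_sqrt_le_measureReal hc hn hε (σ n)

end

theorem mainTheorem3 :
    (∀ (m n : ℕ) (p : unitInterval),
      ∫ ω, randomCutExpectedWeight (weightMatrix (repMatrix ω)) ∂(labelLaw m n p) =
        1 / 4 * ∫ ω, (∑ i, ∑ j, if i ≠ j then weightMatrix (repMatrix ω) i j else 0)
          ∂(labelLaw m n p)) ∧
    ∃ c₀ : ℝ, 0 < c₀ ∧ ∀ c : ℝ, c₀ ≤ c → ∀ δ : ℝ, 0 < δ →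
      ∃ β : ℝ, √(16 / (27 * Real.pi * c ^ 3)) - δ ≤ β ∧
        ∃ ε₀ : ℝ, 0 < ε₀ ∧ ε₀ < 1 ∧ ∀ ε : ℝ, 0 < ε → ε < ε₀ →
          ∀ σ : (n : ℕ) → Equiv.Perm (Fin n),
            Tendsto
              (fun n : ℕ => (labelLaw n n (sparseProb c n)).real
                {ω | (1 + β) * (1 / 4 * ∫ ω', (∑ i, ∑ j,
                        if i ≠ j then weightMatrix (repMatrix ω') i j else 0)
                        ∂(labelLaw n n (sparseProb c n))) ≤
                    majorityExpectedWeight (weightMatrix (repMatrix ω)) (σ n) ε})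
              atTop (𝓝 1) :=
  ⟨integral_randomCutExpectedWeight, 10, by norm_num, fun c hc δ hδ =>
    ⟨√(16 / (27 * Real.pi * c ^ 3)), by linarith, 1 / 10, by norm_num, by norm_num,
      fun _ _ hε σ => mainTheorem3_general hc hε.le σ⟩⟩
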